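/- **Asymptotic normality of the batched OLS estimator for two-arm bandits.** *Setting.* Fix a number of batches $T$, real numbers $\beta_{t,0},\beta_{t,1}$ for $t\in\{1,\dots,T\}$ (not depending on $n$, with no relation imposed between different $t$, and with the margin $\Delta_t:=\beta_{t,1}-\beta_{t,0}$ allowed to be zero), and $\sigma^2\ge 0$. For each batch size $n$ there are, on a probability space that may depend on $n$, actions $A_{t,i}\in\{0,1\}$ and real rewards $R_{t,i}$ for $1\le t\le T$, $1\le i\le n$ (the dependence on $n$ is suppressed). Let $H_{t-1}^{(n)}=\{A_{t',i},R_{t',i}: t'<t,\ 1\le i\le n\}$ be the history before batch $t$ and let $\mathcal G_{t-1}^{(n)}=\sigma\big(H_{t-1}^{(n)}\cup\{A_{t,i}\}_{i=1}^n\big)$. Assume: * (conditionally i.i.d. actions) for every $t$, conditionally on $H_{t-1}^{(n)}$, the actions $A_{t,1},\dots,A_{t,n}$ are i.i.d. $\mathrm{Bernoulli}(\pi_t^{(n)})$, where $\pi_t^{(n)}=\mathbb P(A_{t,i}=1\mid H_{t-1}^{(n)})$; * (rewards) for every $t$, conditionally on $\mathcal G_{t-1}^{(n)}$, the rewards $R_{t,1},\dots,R_{t,n}$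 are independent; they are integrable, with $\mathbb E[R_{t,i}\mid\mathcal G_{t-1}^{(n)}]=(1-A_{t,i})\beta_{t,0}+A_{t,i}\beta_{t,1}$. Let $\epsilon_{t,i}=R_{t,i}-(1-A_{t,i})\beta_{t,0}-A_{t,i}\beta_{t,1}$, $N_{t,1}=\sum_{i=1}^n A_{t,i}$, $N_{t,0}=\sum_{i=1}^n(1-A_{t,i})$, and $$\hat\beta_{t,1}=\frac{\sum_{i=1}^n A_{t,i}R_{t,i}}{N_{t,1}},\qquad \hat\beta_{t,0}=\frac{\sum_{i=1}^n(1-A_{t,i})R_{t,i}}{N_{t,0}},\qquad \hat\Delta_t=\hat\beta_{t,1}-\hat\beta_{t,0}$$ (a quotient with denominator $0$ is read as $0$). Say that *clipping holds at rate $f$* if $\lim_{n\to\infty}\mathbb P\big(\pi_t^{(n)}\in[f(n),1-f(n)]\big)=1$ for every $t\in\{1,\dots,T\}$. *Theorem.* 1. Suppose that for some constant $M<\infty$ and all $t,n,i$, almost surely $\mathbb E[\epsilon_{t,i}^2\mid\mathcal G_{t-1}^{(n)}]=\sigma^2$ and $\mathbb E[\epsilon_{t,i}^4\mid\mathcal G_{t-1}^{(n)}]<M$,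 and that clipping holds at rate $f(n)=n^{-\alpha}$ for some $0\le\alpha<1$. Then, as $n\to\infty$, $$\Big(\sqrt{\tfrac{N_{t,0}N_{t,1}}{n}}\,\big(\hat\Delta_t-\Delta_t\big)\Big)_{t=1}^T\ \xrightarrow{D}\ \mathcal N(0,\sigma^2 I_T).$$ 2. More generally, suppose that for some function $\varphi$, bounded below on $[0,\infty)$ and with $\varphi(x)/x\to\infty$ as $x\to\infty$, and some constant $M<\infty$, for all $t,n,i$, almost surely $\mathbb E[\epsilon_{t,i}^2\mid\mathcal G_{t-1}^{(n)}]=\sigma^2$ and $\mathbb E[\varphi(\epsilon_{t,i}^2)\mid\mathcal G_{t-1}^{(n)}]<M$ (with $\epsilon_{t,i}^2$ and $\varphi(\epsilon_{t,i}^2)$ integrable), and that clipping holds at some rate $f$ with $n f(n)\to\infty$. Then, as $n\to\infty$, $$\Big(\sqrt{N_{t,k}}\,\big(\hat\beta_{t,k}-\beta_{t,k}\big)\Big)_{1\le t\le T,\ k\in\{0,1\}}\ \xrightarrow{D}\ \mathcal N(0,\sigma^2 I_{2T})$$ and $$\Big(\sqrt{\tfrac{N_{t,0}N_{t,1}}{n}}\,\big(\hat\Delta_t-\Delta_t\big)\Big)_{t=1}^T\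 \xrightarrow{D}\ \mathcal N(0,\sigma^2 I_T).$$ -/

import Mathlib

open MeasureTheory ProbabilityTheory Filter Topology

noncomputable section

namespace BatchedBandit

/-- The random variables `X i` are conditionally independent given the sub-σ-algebra `m`:
conditional probabilities of finite intersections of events `{X i ∈ E i}` factorize almost surely.
This is the usual definition, on an arbitrary measurable space (no standard Borel assumption). -/
def CondIndepFamily {Ω ι S : Type*} [MeasurableSpace S] (m : MeasurableSpace Ω)
    {mΩ : MeasurableSpace Ω} (X : ι → Ω → S) (μ : Measure Ω) : Prop :=
  ∀ (J : Finset ι) (E : ι → Set S), (∀ i ∈ J, MeasurableSet (E i)) →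
    μ[(⋂ i ∈ J, X i ⁻¹' E i).indicator (fun _ => (1 : ℝ)) | m] =ᵐ[μ]
      ∏ i ∈ J, μ[(X i ⁻¹' E i).indicator (fun _ => (1 : ℝ)) | m]

section FixedBatchSize

/- A two-arm bandit study with `T` batches of size `n`: `A t i` is the action (arm `0` or `1`) and
`R t i` the reward of the `i`-th sample of batch `t`; `β t k` is the mean reward of arm `k` in
batch `t`. -/

variable {T n : ℕ} {Ω : Type*}

/-- The σ-algebra generated by the history before batch `t`: all actions and rewards of the
batches `s < t`. -/
abbrev history (A : Fin T → Fin n → Ω → Fin 2) (R : Fin T → Fin n → Ω → ℝ) (t : Fin T) :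
    MeasurableSpace Ω :=
  ⨆ (s : Fin T) (_ : s < t) (i : Fin n),
    (MeasurableSpace.comap (A s i) inferInstance ⊔ MeasurableSpace.comap (R s i) inferInstance)

/-- The σ-algebra generated by the history before batch `t` and all the actions of batch `t`. -/
abbrev historyWithActions (A : Fin T → Fin n → Ω → Fin 2) (R : Fin T → Fin n → Ω → ℝ) (t : Fin T) :
    MeasurableSpace Ω :=
  history A R t ⊔ ⨆ i : Fin n, MeasurableSpace.comap (A t i) inferInstance

/-- The error `ε_{t,i} = R_{t,i} - β_{t,A_{t,i}}`. -/
def error (A : Fin T → Fin n → Ω → Fin 2) (R : Fin T → Fin n → Ω → ℝ) (β : Fin T → Fin 2 → ℝ)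
    (t : Fin T) (i : Fin n) (ω : Ω) : ℝ :=
  R t i ω - β t (A t i ω)

/-- `N_{t,k}`, the number of samples of batch `t` in which arm `k` was selected. -/
def armCount (A : Fin T → Fin n → Ω → Fin 2) (t : Fin T) (k : Fin 2) (ω : Ω) : ℕ :=
  (Finset.univ.filter fun i => A t i ω = k).card

/-- The batched OLS estimator of `β_{t,k}`: the average reward of arm `k` in batch `t`. -/
def armEstimator (A : Fin T → Fin n → Ω → Fin 2) (R : Fin T → Fin n → Ω → ℝ)
    (t : Fin T) (k : Fin 2) (ω : Ω) : ℝ :=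
  (∑ i ∈ Finset.univ.filter (fun i => A t i ω = k), R t i ω) / (armCount A t k ω : ℝ)

/-- The margin (treatment effect) `Δ_t = β_{t,1} - β_{t,0}` of batch `t`. -/
def margin (β : Fin T → Fin 2 → ℝ) (t : Fin T) : ℝ :=
  β t 1 - β t 0

/-- The batched OLS estimator of the margin of batch `t`. -/
def marginEstimator (A : Fin T → Fin n → Ω → Fin 2) (R : Fin T → Fin n → Ω → ℝ)
    (t : Fin T) (ω : Ω) : ℝ :=
  armEstimator A R t 1 ω - armEstimator A R t 0 ω

/-- The vector with entries `√N_{t,k} (β̂_{t,k} - β_{t,k})`, over all batches `t` and arms `k`. -/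
def armErrorVector (A : Fin T → Fin n → Ω → Fin 2) (R : Fin T → Fin n → Ω → ℝ)
    (β : Fin T → Fin 2 → ℝ) (ω : Ω) : EuclideanSpace ℝ (Fin T × Fin 2) :=
  WithLp.toLp 2 fun p : Fin T × Fin 2 =>
    √(armCount A p.1 p.2 ω : ℝ) * (armEstimator A R p.1 p.2 ω - β p.1 p.2)

/-- The vector with entries `√(N_{t,0} N_{t,1} / n) (Δ̂_t - Δ_t)`, over all batches `t`. -/
def marginErrorVector (A : Fin T → Fin n → Ω → Fin 2) (R : Fin T → Fin n → Ω → ℝ)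
    (β : Fin T → Fin 2 → ℝ) (ω : Ω) : EuclideanSpace ℝ (Fin T) :=
  WithLp.toLp 2 fun t : Fin T =>
    √((armCount A t 0 ω : ℝ) * (armCount A t 1 ω : ℝ) / (n : ℝ)) *
      (marginEstimator A R t ω - margin β t)

variable [MeasurableSpace Ω]

/-- Given the history, the actions of each batch `t` are i.i.d. Bernoulli with success
probability `π t`. -/
def CondIIDActions (A : Fin T → Fin n → Ω → Fin 2) (R : Fin T → Fin n → Ω → ℝ)
    (π : Fin T → Ω → ℝ) (P : Measure Ω) : Prop :=
  ∀ t : Fin T, CondIndepFamily (history A R t) (A t) P ∧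
    ∀ i : Fin n, P[(A t i ⁻¹' {1}).indicator (fun _ => (1 : ℝ)) | history A R t] =ᵐ[P] π t

/-- The reward model: given the history and the actions of batch `t`, the rewards of batch `t` are
independent, and the conditional mean of `R_{t,i}` is `β_{t,A_{t,i}}`. -/
def RewardModel (A : Fin T → Fin n → Ω → Fin 2) (R : Fin T → Fin n → Ω → ℝ)
    (β : Fin T → Fin 2 → ℝ) (P : Measure Ω) : Prop :=
  ∀ t : Fin T, CondIndepFamily (historyWithActions A R t) (R t) P ∧
    ∀ i : Fin n, Integrable (R t i) P ∧
      P[R t i | historyWithActions A R t] =ᵐ[P] fun ω => β t (A t i ω)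

/-- Conditional variance `σ²` and conditional fourth moment below `M` for all the errors. -/
def Moments (A : Fin T → Fin n → Ω → Fin 2) (R : Fin T → Fin n → Ω → ℝ)
    (β : Fin T → Fin 2 → ℝ) (σ M : ℝ) (P : Measure Ω) : Prop :=
  ∀ (t : Fin T) (i : Fin n),
    Integrable (fun ω => error A R β t i ω ^ 2) P ∧
    P[fun ω => error A R β t i ω ^ 2 | historyWithActions A R t] =ᵐ[P] (fun _ => σ ^ 2) ∧
    Integrable (fun ω => error A R β t i ω ^ 4) P ∧
    ∀ᵐ ω ∂P, (P[fun ω => error A R β t i ω ^ 4 | historyWithActions A R t]) ω < M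

/-- Conditional variance `σ²` and conditional mean of `φ(ε²)` below `M` for all the errors. -/
def WeakMoments (A : Fin T → Fin n → Ω → Fin 2) (R : Fin T → Fin n → Ω → ℝ)
    (β : Fin T → Fin 2 → ℝ) (σ : ℝ) (φ : ℝ → ℝ) (M : ℝ) (P : Measure Ω) : Prop :=
  ∀ (t : Fin T) (i : Fin n),
    Integrable (fun ω => error A R β t i ω ^ 2) P ∧
    P[fun ω => error A R β t i ω ^ 2 | historyWithActions A R t] =ᵐ[P] (fun _ => σ ^ 2) ∧
    Integrable (fun ω => φ (error A R β t i ω ^ 2)) P ∧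
    ∀ᵐ ω ∂P, (P[fun ω => φ (error A R β t i ω ^ 2) | historyWithActions A R t]) ω < M

end FixedBatchSize

/-- The clipping constraint with rate `f`: in every batch, the probability that the action
selection probability lies in `[f n, 1 - f n]` tends to one as the batch size `n` grows. -/
def Clipping {T : ℕ} {Ω : ℕ → Type*} [∀ n, MeasurableSpace (Ω n)] (π : ∀ n, Fin T → Ω n → ℝ)
    (P : ∀ n, Measure (Ω n)) (f : ℕ → ℝ) : Prop :=
  ∀ t : Fin T,
    Tendsto (fun n => P n {ω | π n t ω ∈ Set.Icc (f n) (1 - f n)}) atTop (𝓝 1)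

/-- The normal distribution `N(0, σ² I)` on the Euclidean space with coordinates `ι`. -/
def isotropicGaussian (ι : Type*) [Fintype ι] [DecidableEq ι] (σ : ℝ) :
    Measure (EuclideanSpace ℝ ι) :=
  multivariateGaussian 0 (σ ^ 2 • (1 : Matrix ι ι ℝ))

instance isProbabilityMeasure_isotropicGaussian (ι : Type*) [Fintype ι] [DecidableEq ι] (σ : ℝ) :
    IsProbabilityMeasure (isotropicGaussian ι σ) := by
  unfold isotropicGaussian
  infer_instance

end BatchedBandit

end

namespace BatchedBandit

/-! Conditionally on the history and the actions of batch `t` (the σ-algebra `historyWithActions A R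
t`, below `G`), the actions are frozen and the errors are independent with mean `0` and variance
`σ²`. A linear combination of the normalized arm errors of the batch is a sum `∑ wᵢ εᵢ` whose
weights are functions of the actions. Once every arm has been chosen, `∑ wᵢ²` is a nonrandom number
`v`, and the weights are small when both arm counts are large. Hence the conditional characteristic
function of the batch tends to the nonrandom `exp (-σ² v / 2)`, whatever the selection rule did. A
nonrandom limit is what makes the batches asymptotically independent: the exponential of the earlier
batches is `G`-measurable, the Gaussian factor pulls out of the integral, and induction on the
batches gives the product (`tendsto_integral_cexp_sum_armError`). Lévy's continuity theorem
concludes.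

The conditional limit theorem is Lindeberg's replacement of `exp (i wᵢ εᵢ)` by `exp (-σ² wᵢ² / 2)`,
one sample at a time, carried out under the integral against a bounded `G`-measurable factor `Z`
(`norm_integral_mul_prod_cexp_sub_le`). Conditional independence of the rewards enters through
`CondIndepFamily.condExp_sup_eq`: conditioning also on earlier rewards of the batch changes neither
the mean nor the variance of the next error. Superlinearity of `φ` makes the tails of `ε²` small,
uniformly in all indices.

Arm counts are large because `(1/2) ^ N` has conditional mean `(1 - q/2) ^ n`, which is at most `exp
(-n a / 2)` where `q ≥ a`; so `n f(n) → ∞` makes both counts exceed any fixed `L` with probability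
tending to one.

The margin error has coefficients `√(N₀/n)` and `-√(N₁/n)` on the arm errors. Their squares add up
to `1`, so `v` stays nonrandom even though `N₀/n` need not converge. -/

/-! ### Elementary bounds for exponentials and truncated squares -/

/-- Second order Taylor bound for `exp (i x)`, in a form suited to Lindeberg's condition. -/
theorem norm_cexp_I_mul_sub_taylor_le (x : ℝ) :
    ‖Complex.exp (Complex.I * x) - (1 + Complex.I * x - x ^ 2 / 2)‖ ≤ 4 * min (x ^ 2) (|x| ^ 3) := by
  rcases le_total |x| 1 with hx | hx
  · have h := Complex.exp_bound (x := Complex.I * x) (by simpa using hx) (n := 3) (by norm_num)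
    have e : ∑ m ∈ Finset.range 3, (Complex.I * (x : ℂ)) ^ m / (m.factorial : ℂ)
        = 1 + Complex.I * x - x ^ 2 / 2 := by
      simp [Finset.sum_range_succ, mul_pow, Nat.factorial]
      ring
    rw [e] at h
    refine h.trans ?_
    have h3 : |x| ^ 3 ≤ x ^ 2 := by
      rw [← sq_abs]; exact pow_le_pow_of_le_one (abs_nonneg x) hx (by norm_num)
    rw [min_eq_right h3]
    simp [Nat.factorial]
    nlinarith [pow_nonneg (abs_nonneg x) 3]
  · have h3 : x ^ 2 ≤ |x| ^ 3 := by
      rw [← sq_abs]; exact pow_le_pow_right₀ hx (by norm_num)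
    rw [min_eq_left h3]
    calc _ ≤ ‖Complex.exp (Complex.I * x)‖ + (‖(1 : ℂ)‖ + ‖Complex.I * (x : ℂ)‖ + ‖(x : ℂ) ^ 2 / 2‖) :=
          (norm_sub_le _ _).trans (by gcongr; exact (norm_sub_le _ _).trans (by gcongr; exact norm_add_le _ _))
      _ = 2 + |x| + |x| ^ 2 / 2 := by rw [Complex.norm_exp_I_mul_ofReal]; simp; ring
      _ ≤ _ := by rw [← sq_abs x]; nlinarith

theorem exp_neg_sub_one_add_le {s : ℝ} (hs : 0 ≤ s) : |1 - s - Real.exp (-s)| ≤ s ^ 2 := by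
  have h1 := Real.add_one_le_exp (-s)
  rw [abs_sub_comm, abs_of_nonneg (by linarith)]
  rcases le_total s 1 with h | h
  · have := (abs_le.1 (Real.abs_exp_sub_one_sub_id_le (x := -s) (by rwa [abs_neg, abs_of_nonneg hs]))).2
    nlinarith
  · have : Real.exp (-s) ≤ 1 := Real.exp_le_one_iff.2 (by linarith)
    nlinarith

/-- The truncated square `x² 1{x² > K}`. -/
noncomputable def tailSq (K x : ℝ) : ℝ := if K < x ^ 2 then x ^ 2 else 0

theorem measurable_tailSq (K : ℝ) : Measurable (tailSq K) :=
  Measurable.ite (measurableSet_lt measurable_const (by fun_prop)) (by fun_prop) measurable_const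

theorem tailSq_nonneg (K x : ℝ) : 0 ≤ tailSq K x := by
  unfold tailSq; split_ifs <;> positivity

theorem tailSq_le (K x : ℝ) : tailSq K x ≤ x ^ 2 := by
  unfold tailSq; split_ifs; exacts [le_rfl, sq_nonneg x]

/-- Above the threshold the square is kept; below it, `|x| ≤ √K` trades one factor of the cube for a
constant, leaving a small factor `|w|`. -/
theorem min_sq_cube_le (K w x : ℝ) :
    min ((w * x) ^ 2) (|w * x| ^ 3) ≤ w ^ 2 * tailSq K x + w ^ 2 * |w| * √K * x ^ 2 := by
  unfold tailSq
  split_ifs with h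
  · exact (min_le_left _ _).trans (by rw [mul_pow]; exact le_add_of_nonneg_right (by positivity))
  · refine (min_le_right _ _).trans ?_
    have : |x| ≤ √K := Real.abs_le_sqrt (not_lt.1 h)
    rw [abs_mul, mul_pow, pow_succ |w|, pow_succ |x|, sq_abs, sq_abs, mul_zero, zero_add]
    calc _ = w ^ 2 * |w| * x ^ 2 * |x| := by ring
      _ ≤ w ^ 2 * |w| * x ^ 2 * √K := by gcongr
      _ = _ := by ring

/-! ### Lindeberg replacement under the integral -/

section

variable {Ω : Type*} {mΩ : MeasurableSpace Ω} {μ : Measure Ω}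

/-- This removes the first-order and the centred second-order Taylor terms; `W` carries everything
already determined by `F`. -/
theorem integral_smul_eq_zero_of_condExp [IsFiniteMeasure μ] {F : MeasurableSpace Ω}
    (hF : F ≤ mΩ) {W : Ω → ℂ} (hW : StronglyMeasurable[F] W) {C : ℝ} (hWC : ∀ ω, ‖W ω‖ ≤ C)
    {X : Ω → ℝ} (hX : Integrable X μ) (h0 : μ[X | F] =ᵐ[μ] 0) :
    ∫ ω, X ω • W ω ∂μ = 0 := by
  have hi : Integrable (X • W) μ :=
    hX.smul_bdd C (hW.mono hF).aestronglyMeasurable (Eventually.of_forall hWC)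
  have := condExp_smul_of_aestronglyMeasurable_right hX hi hW.aestronglyMeasurable
  have e : ∫ ω, (X • W) ω ∂μ = 0 := by
    rw [← integral_condExp hF, integral_congr_ae this]
    refine integral_eq_zero_of_ae ?_
    filter_upwards [h0] with ω h
    simp [h]
  exact e

theorem integral_mul_condExp [IsFiniteMeasure μ] {F : MeasurableSpace Ω}
    (hF : F ≤ mΩ) {W : Ω → ℝ} (hW : StronglyMeasurable[F] W) {C : ℝ} (hWC : ∀ ω, ‖W ω‖ ≤ C)
    {X : Ω → ℝ} (hX : Integrable X μ) :
    ∫ ω, W ω * X ω ∂μ = ∫ ω, W ω * (μ[X | F]) ω ∂μ := by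
  have := condExp_stronglyMeasurable_mul_of_bound hF hW hX C (Eventually.of_forall hWC)
  exact (integral_condExp (f := W * X) hF).symm.trans (integral_congr_ae this)

/-- One step of Lindeberg's replacement argument. -/
theorem norm_integral_mul_cexp_sub_le [IsProbabilityMeasure μ] {G F : MeasurableSpace Ω}
    (hGF : G ≤ F) (hF : F ≤ mΩ) {W : Ω → ℂ} (hW : StronglyMeasurable[F] W) (hW1 : ∀ ω, ‖W ω‖ ≤ 1)
    {w : Ω → ℝ} (hw : StronglyMeasurable[G] w) {c : ℝ} (hwc : ∀ ω, |w ω| ≤ c)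
    {ε : Ω → ℝ} (hε : Integrable ε μ) (hε2 : Integrable (fun ω => ε ω ^ 2) μ)
    (h0 : μ[ε | F] =ᵐ[μ] 0) {σ : ℝ} (hσ : μ[fun ω => ε ω ^ 2 | F] =ᵐ[μ] fun _ => σ ^ 2)
    {K η : ℝ} (hη : ∀ᵐ ω ∂μ, (μ[fun ω => tailSq K (ε ω) | G]) ω ≤ η) :
    ‖∫ ω, W ω * (Complex.exp (Complex.I * ((w ω * ε ω : ℝ) : ℂ))
        - (Real.exp (-(σ ^ 2 * w ω ^ 2 / 2)) : ℂ)) ∂μ‖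
      ≤ (4 * η + 4 * c * √K * σ ^ 2 + c ^ 2 * σ ^ 4) * ∫ ω, w ω ^ 2 ∂μ := by
  have hG : G ≤ mΩ := hGF.trans hF
  have hwF := hw.mono hGF
  have hwm := (hw.mono hG)
  have hc : 0 ≤ c := by
    obtain ⟨ω⟩ := nonempty_of_isProbabilityMeasure μ
    exact (abs_nonneg _).trans (hwc ω)
  have hw2c : ∀ ω, w ω ^ 2 ≤ c ^ 2 := fun ω => sq_le_sq' (by linarith [abs_le.1 (hwc ω)]) (abs_le.1 (hwc ω)).2
  have hw2i : Integrable (fun ω => w ω ^ 2) μ :=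
    Integrable.of_bound (hwm.pow 2).aestronglyMeasurable (c ^ 2)
      (Eventually.of_forall fun ω => by rw [Real.norm_of_nonneg (sq_nonneg _)]; exact hw2c ω)
  have hti : Integrable (fun ω => tailSq K (ε ω)) μ := by
    refine hε2.mono ((measurable_tailSq K).comp_aemeasurable hε.aemeasurable).aestronglyMeasurable
      (Eventually.of_forall fun ω => ?_)
    rw [Real.norm_of_nonneg (tailSq_nonneg _ _), Real.norm_of_nonneg (sq_nonneg _)]
    exact tailSq_le _ _
  have hw2b : ∀ ω, ‖w ω ^ 2‖ ≤ c ^ 2 := fun ω => by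
    rw [Real.norm_of_nonneg (sq_nonneg _)]; exact hw2c ω
  -- the two terms that vanish
  have z1 : ∫ ω, ε ω • (W ω * (Complex.I * w ω)) ∂μ = 0 :=
    integral_smul_eq_zero_of_condExp hF (W := fun ω => W ω * (Complex.I * w ω)) (C := c)
      (hW.mul (stronglyMeasurable_const.mul (Complex.continuous_ofReal.comp_stronglyMeasurable hwF)))
      (fun ω => by
        rw [norm_mul, norm_mul, Complex.norm_I, one_mul, Complex.norm_real]
        exact (mul_le_mul (hW1 ω) (hwc ω) (abs_nonneg _) zero_le_one).trans (by simp)) hε h0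
  have hε2' : Integrable (fun ω => ε ω ^ 2 - σ ^ 2) μ := hε2.sub (integrable_const _)
  have z2 : ∫ ω, (ε ω ^ 2 - σ ^ 2) • (W ω * (w ω : ℂ) ^ 2) ∂μ = 0 := by
    refine integral_smul_eq_zero_of_condExp hF (W := fun ω => W ω * (w ω : ℂ) ^ 2) (C := c ^ 2)
      (hW.mul ((Complex.continuous_ofReal.comp_stronglyMeasurable hwF).pow 2)) (fun ω => ?_) hε2' ?_
    · rw [norm_mul, norm_pow, Complex.norm_real, Real.norm_eq_abs, sq_abs]
      exact (mul_le_mul (hW1 ω) (hw2c ω) (sq_nonneg _) zero_le_one).trans (by simp)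
    · have := condExp_sub hε2 (integrable_const (σ ^ 2)) F (μ := μ)
      refine this.trans ?_
      rw [condExp_const hF]
      filter_upwards [hσ] with ω h
      simp [h]
  -- integrability
  have i1 : Integrable (fun ω => ε ω • (W ω * (Complex.I * w ω))) μ :=
    hε.smul_bdd c ((hW.mono hF).mul (stronglyMeasurable_const.mul
      (Complex.continuous_ofReal.comp_stronglyMeasurable hwm))).aestronglyMeasurable
      (Eventually.of_forall fun ω => by
        rw [norm_mul, norm_mul, Complex.norm_I, one_mul, Complex.norm_real]
        exact (mul_le_mul (hW1 ω) (hwc ω) (abs_nonneg _) zero_le_one).trans (by simp))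
  have i2 : Integrable (fun ω => (ε ω ^ 2 - σ ^ 2) • (W ω * (w ω : ℂ) ^ 2)) μ :=
    hε2'.smul_bdd (c ^ 2) ((hW.mono hF).mul
      ((Complex.continuous_ofReal.comp_stronglyMeasurable hwm).pow 2)).aestronglyMeasurable
      (Eventually.of_forall fun ω => by
        rw [norm_mul, norm_pow, Complex.norm_real, Real.norm_eq_abs, sq_abs]
        exact (mul_le_mul (hW1 ω) (hw2c ω) (sq_nonneg _) zero_le_one).trans (by simp))
  have i3 : Integrable (fun ω => W ω * (Complex.exp (Complex.I * ((w ω * ε ω : ℝ) : ℂ))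
        - (Real.exp (-(σ ^ 2 * w ω ^ 2 / 2)) : ℂ))) μ := by
    refine Integrable.of_bound (C := 2) ?_ (Eventually.of_forall fun ω => ?_)
    · have a1 : AEStronglyMeasurable[mΩ] (fun ω => w ω * ε ω) μ :=
        hwm.aestronglyMeasurable.mul hε.aestronglyMeasurable
      refine (hW.mono hF).aestronglyMeasurable.mul (.sub ?_ ?_)
      · exact (show Continuous fun x : ℝ => Complex.exp (Complex.I * (x : ℂ)) by
          fun_prop).comp_aestronglyMeasurable a1
      · exact (show Continuous fun x : ℝ => ((Real.exp (-(σ ^ 2 * x ^ 2 / 2)) : ℝ) : ℂ) by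
          fun_prop).comp_aestronglyMeasurable hwm.aestronglyMeasurable
    · rw [norm_mul]
      have : ‖Complex.exp (Complex.I * ((w ω * ε ω : ℝ) : ℂ))
        - (Real.exp (-(σ ^ 2 * w ω ^ 2 / 2)) : ℂ)‖ ≤ 1 + 1 := by
        refine (norm_sub_le _ _).trans (add_le_add (Complex.norm_exp_I_mul_ofReal _).le ?_)
        rw [Complex.norm_real, Real.norm_of_nonneg (Real.exp_pos _).le]
        exact Real.exp_le_one_iff.2 (by nlinarith [sq_nonneg (σ * w ω)])
      nlinarith [hW1 ω, norm_nonneg (W ω)]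
  -- The terms `z1` and `z2` integrate to zero, so they may be inserted to turn the difference of
  -- exponentials into a difference of Taylor remainders.
  have key : ∫ ω, W ω * (Complex.exp (Complex.I * ((w ω * ε ω : ℝ) : ℂ))
        - (Real.exp (-(σ ^ 2 * w ω ^ 2 / 2)) : ℂ)) ∂μ
      = ∫ ω, (W ω * (Complex.exp (Complex.I * ((w ω * ε ω : ℝ) : ℂ))
        - (Real.exp (-(σ ^ 2 * w ω ^ 2 / 2)) : ℂ)) - ε ω • (W ω * (Complex.I * w ω))
        + (1 / 2 : ℂ) * (ε ω ^ 2 - σ ^ 2) • (W ω * (w ω : ℂ) ^ 2)) ∂μ := by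
    have e := integral_add (i3.sub i1) (i2.const_mul (1 / 2 : ℂ))
    have e' := integral_sub i3 i1
    simp only [Pi.sub_apply] at e
    rw [e, e', z1, integral_const_mul, z2]
    simp
  rw [key]
  have bound : ∀ ω, ‖W ω * (Complex.exp (Complex.I * ((w ω * ε ω : ℝ) : ℂ))
        - (Real.exp (-(σ ^ 2 * w ω ^ 2 / 2)) : ℂ)) - ε ω • (W ω * (Complex.I * w ω))
        + (1 / 2 : ℂ) * (ε ω ^ 2 - σ ^ 2) • (W ω * (w ω : ℂ) ^ 2)‖
      ≤ 4 * (w ω ^ 2 * tailSq K (ε ω)) + 4 * c * √K * (w ω ^ 2 * ε ω ^ 2)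
        + c ^ 2 * σ ^ 4 * w ω ^ 2 := by
    intro ω
    have t1 := norm_cexp_I_mul_sub_taylor_le (w ω * ε ω)
    have t2 := exp_neg_sub_one_add_le (s := σ ^ 2 * w ω ^ 2 / 2) (by positivity)
    have t3 := min_sq_cube_le K (w ω) (ε ω)
    -- The remainder of `exp (i w ε)` at order two, plus the first-order remainder of `exp (-s)`
    -- with `s = σ² w² / 2`.
    have e : W ω * (Complex.exp (Complex.I * ((w ω * ε ω : ℝ) : ℂ))
        - (Real.exp (-(σ ^ 2 * w ω ^ 2 / 2)) : ℂ)) - ε ω • (W ω * (Complex.I * w ω))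
        + (1 / 2 : ℂ) * (ε ω ^ 2 - σ ^ 2) • (W ω * (w ω : ℂ) ^ 2)
        = W ω * ((Complex.exp (Complex.I * ((w ω * ε ω : ℝ) : ℂ))
          - (1 + Complex.I * ((w ω * ε ω : ℝ) : ℂ) - ((w ω * ε ω : ℝ) : ℂ) ^ 2 / 2))
          + ((1 - σ ^ 2 * w ω ^ 2 / 2 - Real.exp (-(σ ^ 2 * w ω ^ 2 / 2)) : ℝ) : ℂ)) := by
      simp only [Complex.real_smul]
      push_cast
      ring
    rw [e, norm_mul]
    have n2 : ‖((1 - σ ^ 2 * w ω ^ 2 / 2 - Real.exp (-(σ ^ 2 * w ω ^ 2 / 2)) : ℝ) : ℂ)‖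
        ≤ c ^ 2 * σ ^ 4 * w ω ^ 2 := by
      rw [Complex.norm_real, Real.norm_eq_abs]
      refine t2.trans ?_
      have : w ω ^ 2 * w ω ^ 2 ≤ c ^ 2 * w ω ^ 2 :=
        mul_le_mul_of_nonneg_right (hw2c ω) (sq_nonneg _)
      nlinarith [mul_le_mul_of_nonneg_left this (by positivity : 0 ≤ σ ^ 4),
        (by positivity : 0 ≤ c ^ 2 * σ ^ 4 * w ω ^ 2)]
    have n1 : 4 * min ((w ω * ε ω) ^ 2) (|w ω * ε ω| ^ 3)
        ≤ 4 * (w ω ^ 2 * tailSq K (ε ω)) + 4 * c * √K * (w ω ^ 2 * ε ω ^ 2) := by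
      have : w ω ^ 2 * |w ω| * √K * ε ω ^ 2 ≤ w ω ^ 2 * c * √K * ε ω ^ 2 := by
        gcongr; exact hwc ω
      linarith
    calc _ ≤ 1 * (_ + _) := mul_le_mul (hW1 ω) (norm_add_le _ _) (norm_nonneg _) zero_le_one
      _ ≤ _ := by rw [one_mul]; exact add_le_add (t1.trans n1) n2
  have j1 : Integrable (fun ω => w ω ^ 2 * tailSq K (ε ω)) μ :=
    hti.bdd_mul (c := c ^ 2) (hwm.pow 2).aestronglyMeasurable (Eventually.of_forall hw2b)
  have j2 : Integrable (fun ω => w ω ^ 2 * ε ω ^ 2) μ :=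
    hε2.bdd_mul (c := c ^ 2) (hwm.pow 2).aestronglyMeasurable (Eventually.of_forall hw2b)
  refine (norm_integral_le_of_norm_le (((j1.const_mul 4).add (j2.const_mul (4 * c * √K))).add
    (hw2i.const_mul (c ^ 2 * σ ^ 4))) (Eventually.of_forall bound)).trans ?_
  have s1 := integral_add ((j1.const_mul 4).add (j2.const_mul (4 * c * √K)))
    (hw2i.const_mul (c ^ 2 * σ ^ 4))
  have s2 := integral_add (j1.const_mul 4) (j2.const_mul (4 * c * √K))
  simp only [Pi.add_apply] at s1 ⊢
  rw [s1, s2, integral_const_mul, integral_const_mul,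
    integral_const_mul]
  have e2 : ∫ ω, w ω ^ 2 * ε ω ^ 2 ∂μ = σ ^ 2 * ∫ ω, w ω ^ 2 ∂μ := by
    rw [integral_mul_condExp hF (W := fun ω => w ω ^ 2) (hwF.pow 2) (C := c ^ 2) hw2b hε2, ← integral_const_mul]
    refine integral_congr_ae ?_
    filter_upwards [hσ] with ω h
    simp only [h]; ring
  -- Taking norms has removed `W`; only the `G`-measurable `w` remains, so the tail bound given the
  -- smaller `G` suffices.
  have e1 : ∫ ω, w ω ^ 2 * tailSq K (ε ω) ∂μ ≤ η * ∫ ω, w ω ^ 2 ∂μ := by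
    rw [integral_mul_condExp hG (W := fun ω => w ω ^ 2) (hw.pow 2) (C := c ^ 2) hw2b hti, ← integral_const_mul]
    refine integral_mono_ae (integrable_condExp.bdd_mul (c := c ^ 2)
      (hwm.pow 2).aestronglyMeasurable (Eventually.of_forall hw2b)) (hw2i.const_mul _) ?_
    filter_upwards [hη] with ω h
    exact (mul_le_mul_of_nonneg_left h (sq_nonneg _)).trans_eq (mul_comm _ _)
  rw [e2]
  nlinarith

/-- Lindeberg's replacement argument for a weighted sum of martingale differences. -/
theorem norm_integral_mul_prod_cexp_sub_le [IsProbabilityMeasure μ] {G : MeasurableSpace Ω}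
    (hG : G ≤ mΩ) {c σ K η : ℝ} {n : ℕ} (F : Fin n → MeasurableSpace Ω) (hGF : ∀ i, G ≤ F i)
    (hF : ∀ i, F i ≤ mΩ) (w ε : Fin n → Ω → ℝ) (hw : ∀ i, StronglyMeasurable[G] (w i))
    (hwc : ∀ i ω, |w i ω| ≤ c) (hεF : ∀ i j, j < i → StronglyMeasurable[F i] (ε j))
    (hε : ∀ i, Measurable[mΩ] (ε i)) (hεi : ∀ i, Integrable (ε i) μ)
    (hε2 : ∀ i, Integrable (fun ω => ε i ω ^ 2) μ)
    (h0 : ∀ i, μ[ε i | F i] =ᵐ[μ] 0) (hσ : ∀ i, μ[fun ω => ε i ω ^ 2 | F i] =ᵐ[μ] fun _ => σ ^ 2)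
    (hη : ∀ i, ∀ᵐ ω ∂μ, (μ[fun ω => tailSq K (ε i ω) | G]) ω ≤ η)
    (Z : Ω → ℂ) (hZ : StronglyMeasurable[G] Z) (hZ1 : ∀ ω, ‖Z ω‖ ≤ 1) :
    ‖∫ ω, Z ω * ∏ i, Complex.exp (Complex.I * ((w i ω * ε i ω : ℝ) : ℂ)) ∂μ
        - ∫ ω, Z ω * ∏ i, (Real.exp (-(σ ^ 2 * w i ω ^ 2 / 2)) : ℂ) ∂μ‖
      ≤ (4 * η + 4 * c * √K * σ ^ 2 + c ^ 2 * σ ^ 4) * ∑ i, ∫ ω, w i ω ^ 2 ∂μ := by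
  induction n generalizing Z with
  | zero => simp
  | succ n ih =>
    set l := Fin.last n
    have cE : Continuous fun x : ℝ => Complex.exp (Complex.I * (x : ℂ)) := by fun_prop
    have cg : Continuous fun x : ℝ => ((Real.exp (-(σ ^ 2 * x ^ 2 / 2)) : ℝ) : ℂ) := by fun_prop
    have nE : ∀ i ω, ‖Complex.exp (Complex.I * ((w i ω * ε i ω : ℝ) : ℂ))‖ = 1 :=
      fun i ω => Complex.norm_exp_I_mul_ofReal _
    have ng : ∀ i ω, ‖(Real.exp (-(σ ^ 2 * w i ω ^ 2 / 2)) : ℂ)‖ ≤ 1 := fun i ω => by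
      rw [Complex.norm_real, Real.norm_of_nonneg (Real.exp_pos _).le]
      exact Real.exp_le_one_iff.2 (by nlinarith [sq_nonneg (σ * w i ω)])
    have hE : ∀ i, StronglyMeasurable[mΩ] fun ω => Complex.exp (Complex.I * ((w i ω * ε i ω : ℝ) : ℂ)) :=
      fun i => cE.comp_stronglyMeasurable (((hw i).mono hG).mul (hε i).stronglyMeasurable)
    have hEF : ∀ i : Fin n, StronglyMeasurable[F l]
        fun ω => Complex.exp (Complex.I * ((w i.castSucc ω * ε i.castSucc ω : ℝ) : ℂ)) :=
      fun i => cE.comp_stronglyMeasurable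
        (((hw _).mono (hGF l)).mul (hεF l i.castSucc (Fin.castSucc_lt_last i)))
    have hg : ∀ i, StronglyMeasurable[G] fun ω => (Real.exp (-(σ ^ 2 * w i ω ^ 2 / 2)) : ℂ) :=
      fun i => cg.comp_stronglyMeasurable (hw i)
    -- The last sample is exchanged first, with `Z` and the earlier exponentials as an `F
    -- l`-measurable factor. Its Gaussian replacement depends only on `w l`, hence is `G`-measurable
    -- and can be absorbed into `Z` for the remaining samples.
    have IH := ih (fun i => F i.castSucc) (fun i => hGF _) (fun i => hF _)
      (fun i => w i.castSucc) (fun i => ε i.castSucc) (fun i => hw _) (fun i => hwc _)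
      (fun i j hij => hεF _ _ (Fin.castSucc_lt_castSucc_iff.2 hij)) (fun i => hε _) (fun i => hεi _)
      (fun i => hε2 _) (fun i => h0 _) (fun i => hσ _) (fun i => hη _)
      (fun ω => Z ω * (Real.exp (-(σ ^ 2 * w l ω ^ 2 / 2)) : ℂ)) (hZ.mul (hg l))
      (fun ω => by
        rw [norm_mul]; exact (mul_le_mul (hZ1 ω) (ng l ω) (norm_nonneg _) zero_le_one).trans (by simp))
    have hpF : StronglyMeasurable[F l] fun ω => ∏ i : Fin n,
        Complex.exp (Complex.I * ((w i.castSucc ω * ε i.castSucc ω : ℝ) : ℂ)) :=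
      Finset.stronglyMeasurable_fun_prod _ fun i _ => hEF i
    have hnp : ∀ ω, ‖Z ω * ∏ i : Fin n,
        Complex.exp (Complex.I * ((w i.castSucc ω * ε i.castSucc ω : ℝ) : ℂ))‖ ≤ 1 := fun ω => by
      rw [norm_mul, norm_prod, Finset.prod_congr rfl fun i _ => nE i.castSucc ω]
      simpa using hZ1 ω
    have st := norm_integral_mul_cexp_sub_le (hGF l) (hF l) ((hZ.mono (hGF l)).mul hpF) hnp
      (hw l) (hwc l) (hεi l) (hε2 l) (h0 l) (hσ l) (hη l)
    have I1 : Integrable (fun ω => (Z ω * ∏ i : Fin n,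
        Complex.exp (Complex.I * ((w i.castSucc ω * ε i.castSucc ω : ℝ) : ℂ))) *
          Complex.exp (Complex.I * ((w l ω * ε l ω : ℝ) : ℂ))) μ :=
      Integrable.of_bound ((((hZ.mono (hGF l)).mul hpF).mono (hF l)).mul (hE l)).aestronglyMeasurable 1
        (Eventually.of_forall fun ω => by rw [norm_mul, nE, mul_one]; exact hnp ω)
    have I2 : Integrable (fun ω => (Z ω * ∏ i : Fin n,
        Complex.exp (Complex.I * ((w i.castSucc ω * ε i.castSucc ω : ℝ) : ℂ))) *
          (Real.exp (-(σ ^ 2 * w l ω ^ 2 / 2)) : ℂ)) μ :=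
      Integrable.of_bound ((((hZ.mono (hGF l)).mul hpF).mono (hF l)).mul
        ((hg l).mono hG)).aestronglyMeasurable 1
        (Eventually.of_forall fun ω => by
          rw [norm_mul]
          exact (mul_le_mul (hnp ω) (ng l ω) (norm_nonneg _) zero_le_one).trans (by simp))
    have e1 : ∫ ω, Z ω * ∏ i, Complex.exp (Complex.I * ((w i ω * ε i ω : ℝ) : ℂ)) ∂μ
        - ∫ ω, Z ω * ∏ i, (Real.exp (-(σ ^ 2 * w i ω ^ 2 / 2)) : ℂ) ∂μ
        = ∫ ω, (Z ω * ∏ i : Fin n,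
            Complex.exp (Complex.I * ((w i.castSucc ω * ε i.castSucc ω : ℝ) : ℂ))) *
            (Complex.exp (Complex.I * ((w l ω * ε l ω : ℝ) : ℂ))
              - (Real.exp (-(σ ^ 2 * w l ω ^ 2 / 2)) : ℂ)) ∂μ
          + (∫ ω, (Z ω * (Real.exp (-(σ ^ 2 * w l ω ^ 2 / 2)) : ℂ)) * ∏ i : Fin n,
            Complex.exp (Complex.I * ((w i.castSucc ω * ε i.castSucc ω : ℝ) : ℂ)) ∂μ
          - ∫ ω, (Z ω * (Real.exp (-(σ ^ 2 * w l ω ^ 2 / 2)) : ℂ)) * ∏ i : Fin n,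
            (Real.exp (-(σ ^ 2 * w i.castSucc ω ^ 2 / 2)) : ℂ) ∂μ) := by
      simp only [Fin.prod_univ_castSucc, mul_sub]
      rw [integral_sub I1 I2]
      have a : ∀ ω, Z ω * ((∏ i : Fin n,
            Complex.exp (Complex.I * ((w i.castSucc ω * ε i.castSucc ω : ℝ) : ℂ))) *
            Complex.exp (Complex.I * ((w l ω * ε l ω : ℝ) : ℂ))) = (Z ω * ∏ i : Fin n,
            Complex.exp (Complex.I * ((w i.castSucc ω * ε i.castSucc ω : ℝ) : ℂ))) *
            Complex.exp (Complex.I * ((w l ω * ε l ω : ℝ) : ℂ)) := fun ω => by ring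
      have b : ∀ ω, (Z ω * ∏ i : Fin n,
            Complex.exp (Complex.I * ((w i.castSucc ω * ε i.castSucc ω : ℝ) : ℂ))) *
            (Real.exp (-(σ ^ 2 * w l ω ^ 2 / 2)) : ℂ) =
            (Z ω * (Real.exp (-(σ ^ 2 * w l ω ^ 2 / 2)) : ℂ)) * ∏ i : Fin n,
            Complex.exp (Complex.I * ((w i.castSucc ω * ε i.castSucc ω : ℝ) : ℂ)) := fun ω => by ring
      have d : ∀ ω, Z ω * ((∏ i : Fin n, (Real.exp (-(σ ^ 2 * w i.castSucc ω ^ 2 / 2)) : ℂ)) *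
            (Real.exp (-(σ ^ 2 * w l ω ^ 2 / 2)) : ℂ)) =
            (Z ω * (Real.exp (-(σ ^ 2 * w l ω ^ 2 / 2)) : ℂ)) * ∏ i : Fin n,
            (Real.exp (-(σ ^ 2 * w i.castSucc ω ^ 2 / 2)) : ℂ) := fun ω => by ring
      simp only [a, b, d, l]
      ring
    rw [e1, Fin.sum_univ_castSucc, mul_add]
    refine (norm_add_le _ _).trans ?_
    rw [add_comm]
    exact add_le_add IH st

end

/-! ### Conditional independence and enlarged conditioning -/

section

variable {Ω : Type*} {mΩ : MeasurableSpace Ω} {μ : Measure Ω}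

/-- The intersections of a set of the σ-algebra `m` with a member of `P`. -/
def interSets (m : MeasurableSpace Ω) (P : Set (Set Ω)) : Set (Set Ω) :=
  {s | ∃ C D, MeasurableSet[m] C ∧ D ∈ P ∧ s = C ∩ D}

theorem isPiSystem_interSets (m : MeasurableSpace Ω) {P : Set (Set Ω)} (hP : IsPiSystem P) :
    IsPiSystem (interSets m P) := by
  rintro _ ⟨C, D, hC, hD, rfl⟩ _ ⟨C', D', hC', hD', rfl⟩ hne
  rw [Set.inter_inter_inter_comm] at hne ⊢
  exact ⟨_, _, hC.inter hC', hP _ hD _ hD' hne.right, rfl⟩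

theorem generateFrom_interSets (m : MeasurableSpace Ω) {P : Set (Set Ω)} (hP : Set.univ ∈ P) :
    MeasurableSpace.generateFrom (interSets m P) = m ⊔ MeasurableSpace.generateFrom P := by
  refine le_antisymm (MeasurableSpace.generateFrom_le ?_) (sup_le ?_ ?_)
  · rintro _ ⟨C, D, hC, hD, rfl⟩
    exact MeasurableSet.inter (le_sup_left (a := m) _ hC)
      (le_sup_right (a := m) _ (MeasurableSpace.measurableSet_generateFrom hD))
  · exact fun C hC => MeasurableSpace.measurableSet_generateFrom ⟨C, _, hC, hP, by simp⟩
  · exact MeasurableSpace.generateFrom_le fun D hD =>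
      MeasurableSpace.measurableSet_generateFrom ⟨_, D, MeasurableSet.univ, hD, by simp⟩

/-- Dynkin's π-λ argument for signed integrals; `univ ∈ P` supplies the equality of total integrals
needed for complements. -/
theorem setIntegral_eq_of_isPiSystem {m : MeasurableSpace Ω} (hm : m ≤ mΩ) {P : Set (Set Ω)}
    (hP : IsPiSystem P) (hgen : m = MeasurableSpace.generateFrom P) (hu : Set.univ ∈ P)
    {f g : Ω → ℝ} (hf : Integrable f μ) (hg : Integrable g μ)
    (h : ∀ s ∈ P, ∫ ω in s, f ω ∂μ = ∫ ω in s, g ω ∂μ) {s : Set Ω} (hs : MeasurableSet[m] s) :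
    ∫ ω in s, f ω ∂μ = ∫ ω in s, g ω ∂μ := by
  induction s, hs using MeasurableSpace.induction_on_inter hgen hP with
  | empty => simp
  | basic t ht => exact h t ht
  | compl t ht ih =>
    have hU := h _ hu
    rw [setIntegral_univ, setIntegral_univ] at hU
    rw [setIntegral_compl (hm _ ht) hf, setIntegral_compl (hm _ ht) hg, hU, ih]
  | iUnion t hd ht ih =>
    rw [integral_iUnion (fun i => hm _ (ht i)) hd hf.integrableOn,
      integral_iUnion (fun i => hm _ (ht i)) hd hg.integrableOn]
    exact tsum_congr ih

/-- Self-adjointness of conditional expectation: both sides equal the integral of the product of the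
two conditional expectations. -/
theorem integral_condExp_mul_condExp [IsProbabilityMeasure μ] {m : MeasurableSpace Ω} (hm : m ≤ mΩ)
    {D : Set Ω} (hD : MeasurableSet[mΩ] D) {f : Ω → ℝ} (hf : Integrable f μ) :
    ∫ ω, (μ[D.indicator (fun _ => (1 : ℝ)) | m]) ω * f ω ∂μ
      = ∫ ω, D.indicator (fun _ => (1 : ℝ)) ω * (μ[f | m]) ω ∂μ := by
  set d : Ω → ℝ := D.indicator fun _ => (1 : ℝ)
  have hdi : Integrable d μ := (integrable_const _).indicator hD
  have hd1 : ∀ ω, ‖d ω‖ ≤ 1 := fun ω => by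
    by_cases h : ω ∈ D <;> simp [d, h]
  have hdm : AEStronglyMeasurable[mΩ] d μ := hdi.aestronglyMeasurable
  have hcd : ∀ᵐ ω ∂μ, ‖(μ[d | m]) ω‖ ≤ 1 := by
    exact ae_bdd_abs_condExp_of_ae_bdd_abs (R := 1) (m := m) (μ := μ) (f := d)
      (Eventually.of_forall hd1)
  have h1 := condExp_stronglyMeasurable_mul_of_bound hm (stronglyMeasurable_condExp (μ := μ) (f := d))
    hf 1 hcd
  have h2 : μ[d * μ[f | m] | m] =ᵐ[μ] μ[d | m] * μ[f | m] :=
    condExp_mul_of_stronglyMeasurable_right stronglyMeasurable_condExp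
      (integrable_condExp.bdd_mul (c := 1) hdm (Eventually.of_forall hd1)) hdi
  calc _ = ∫ ω, (μ[d | m] * f) ω ∂μ := rfl
    _ = ∫ ω, (μ[d | m] * μ[f | m]) ω ∂μ := by rw [← integral_condExp hm]; exact integral_congr_ae h1
    _ = ∫ ω, (d * μ[f | m]) ω ∂μ := by
      rw [← integral_condExp hm (f := d * μ[f | m])]; exact (integral_congr_ae h2).symm

/-- If the event `D` is conditionally independent of `m₂` given `m`, conditioning on `D` in addition
to `m` does not change the conditional mean of functions measurable with respect to `m ⊔ m₂`. -/
theorem setIntegral_condExp_of_condIndep [IsProbabilityMeasure μ] {m m₂ : MeasurableSpace Ω}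
    (hm : m ≤ mΩ) (hm₂ : m₂ ≤ mΩ) {D : Set Ω} (hD : MeasurableSet[mΩ] D)
    (hind : ∀ B, MeasurableSet[m₂] B → μ[(D ∩ B).indicator (fun _ => (1 : ℝ)) | m] =ᵐ[μ]
      μ[D.indicator (fun _ => (1 : ℝ)) | m] * μ[B.indicator (fun _ => (1 : ℝ)) | m])
    {f : Ω → ℝ} (hf : Integrable f μ) (hfm : StronglyMeasurable[m ⊔ m₂] f)
    {C : Set Ω} (hC : MeasurableSet[m] C) :
    ∫ ω in C ∩ D, (μ[f | m]) ω ∂μ = ∫ ω in C ∩ D, f ω ∂μ := by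
  have hm' : m ⊔ m₂ ≤ mΩ := sup_le hm hm₂
  set d : Ω → ℝ := D.indicator fun _ => (1 : ℝ) with hd_def
  have hdi : Integrable d μ := (integrable_const _).indicator hD
  have hd1 : ∀ ω, ‖d ω‖ ≤ 1 := fun ω => by
    by_cases h : ω ∈ D <;> simp [d, h]
  -- the conditional probability of `D` does not change when `m₂` is added
  have hdcond : μ[d | m ⊔ m₂] =ᵐ[μ] μ[d | m] := by
    refine (ae_eq_condExp_of_forall_setIntegral_eq hm' hdi
      (fun s _ _ => integrable_condExp.integrableOn) (fun s hs _ => ?_)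
      (stronglyMeasurable_condExp.mono le_sup_left).aestronglyMeasurable).symm
    refine setIntegral_eq_of_isPiSystem hm' (P := interSets m {B | MeasurableSet[m₂] B})
      (isPiSystem_interSets m (@MeasurableSpace.isPiSystem_measurableSet Ω m₂)) ?_ ?_ integrable_condExp hdi ?_ hs
    · rw [generateFrom_interSets m (P := {B | MeasurableSet[m₂] B}) MeasurableSet.univ, MeasurableSpace.generateFrom_measurableSet]
    · exact ⟨Set.univ, Set.univ, MeasurableSet.univ, MeasurableSet.univ, by simp⟩
    · rintro _ ⟨C', B, hC', hB, rfl⟩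
      have hB' := hm₂ _ hB
      have hbi : Integrable (B.indicator fun _ => (1 : ℝ)) μ := (integrable_const _).indicator hB'
      have e1 : ∫ ω in C' ∩ B, d ω ∂μ = ∫ ω in C', ((D ∩ B).indicator fun _ => (1 : ℝ)) ω ∂μ := by
        rw [← setIntegral_indicator hB']
        congr 1; ext ω
        by_cases h1 : ω ∈ D <;> by_cases h2 : ω ∈ B <;> simp [d, h1, h2]
      have e2 : ∫ ω in C' ∩ B, (μ[d | m]) ω ∂μ
          = ∫ ω in C', (μ[d | m] * (B.indicator fun _ => (1 : ℝ))) ω ∂μ := by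
        rw [← setIntegral_indicator hB']
        congr 1; ext ω
        by_cases h2 : ω ∈ B <;> simp [h2]
      have hint : Integrable (μ[d | m] * (B.indicator fun _ => (1 : ℝ))) μ :=
        integrable_condExp.mul_bdd (c := 1) hbi.aestronglyMeasurable
          (Eventually.of_forall fun ω => by by_cases h : ω ∈ B <;> simp [h])
      rw [e1, e2, ← setIntegral_condExp hm hint hC',
        ← setIntegral_condExp hm ((integrable_const (1 : ℝ)).indicator (hD.inter hB')) hC']
      refine setIntegral_congr_ae (hm _ hC') ?_
      filter_upwards [hind B hB,
        condExp_mul_of_stronglyMeasurable_left stronglyMeasurable_condExp hint hbi] with ω h1 h2 _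
      rw [h1, h2]
  -- the function restricted to `C`
  have hC' := hm _ hC
  set g : Ω → ℝ := C.indicator f with hg_def
  have hg : Integrable g μ := hf.indicator hC'
  have hgm : StronglyMeasurable[m ⊔ m₂] g := hfm.indicator (le_sup_left (a := m) _ hC)
  -- As `g` is measurable for `m ⊔ m₂`, the indicator `d` may be replaced by its conditional mean,
  -- which is the one given `m`. Self-adjointness then moves the conditioning from `d` to `g`.
  have c1 : ∫ ω, d ω * g ω ∂μ = ∫ ω, (μ[d | m]) ω * g ω ∂μ := by
    have := condExp_mul_of_stronglyMeasurable_right hgm (μ := μ)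
      (hg.bdd_mul (c := 1) hdi.aestronglyMeasurable (Eventually.of_forall hd1)) hdi
    calc _ = ∫ ω, (d * g) ω ∂μ := rfl
      _ = ∫ ω, (μ[d | m ⊔ m₂] * g) ω ∂μ := by
        rw [← integral_condExp hm']; exact integral_congr_ae this
      _ = _ := integral_congr_ae (by filter_upwards [hdcond] with ω h; simp [h])
  rw [integral_condExp_mul_condExp hm hD hg] at c1
  have c2 : ∫ ω, d ω * (μ[g | m]) ω ∂μ = ∫ ω in C ∩ D, (μ[f | m]) ω ∂μ := by
    rw [← integral_indicator (hC'.inter hD)]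
    refine integral_congr_ae ?_
    filter_upwards [condExp_indicator hf hC] with ω h
    rw [h]
    by_cases h1 : ω ∈ C <;> by_cases h2 : ω ∈ D <;> simp [d, h1, h2]
  have c3 : ∫ ω, d ω * g ω ∂μ = ∫ ω in C ∩ D, f ω ∂μ := by
    rw [← integral_indicator (hC'.inter hD)]
    congr 1; ext ω
    by_cases h1 : ω ∈ C <;> by_cases h2 : ω ∈ D <;> simp [d, g, h1, h2]
  rw [← c2, ← c1, c3]

/-- Given `m`, adding other members of a conditionally independent family to the conditioning does
not change the conditional mean of a function of `X i` and `m`. -/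
theorem CondIndepFamily.condExp_sup_eq [IsProbabilityMeasure μ] {m : MeasurableSpace Ω}
    (hm : m ≤ mΩ) {ι : Type*} {X : ι → Ω → ℝ} (hX : ∀ i, Measurable[mΩ] (X i))
    (h : CondIndepFamily m X μ) {i : ι} {S : Set ι} (hi : i ∉ S) {f : Ω → ℝ} (hf : Integrable f μ)
    (hfm : StronglyMeasurable[m ⊔ MeasurableSpace.comap (X i) inferInstance] f) :
    μ[f | m ⊔ ⨆ j ∈ S, MeasurableSpace.comap (X j) inferInstance] =ᵐ[μ] μ[f | m] := by
  classical
  have hcomap : ∀ j, MeasurableSpace.comap (X j) inferInstance ≤ mΩ := fun j => (hX j).comap_le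
  have hle : m ⊔ ⨆ j ∈ S, MeasurableSpace.comap (X j) inferInstance ≤ mΩ :=
    sup_le hm (iSup₂_le fun j _ => hcomap j)
  set P := piiUnionInter (fun j => {s | MeasurableSet[MeasurableSpace.comap (X j) inferInstance] s}) S
    with hP
  have hPu : Set.univ ∈ P := ⟨∅, by simp, fun _ => Set.univ, by simp, by simp⟩
  refine (ae_eq_condExp_of_forall_setIntegral_eq hle hf
      (fun s _ _ => integrable_condExp.integrableOn) (fun s hs _ => ?_)
      (stronglyMeasurable_condExp.mono le_sup_left).aestronglyMeasurable).symm
  refine setIntegral_eq_of_isPiSystem hle (P := interSets m P)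
      (isPiSystem_interSets m (isPiSystem_piiUnionInter _
        (fun j => @MeasurableSpace.isPiSystem_measurableSet Ω (MeasurableSpace.comap (X j) inferInstance)) S))
      ?_ ⟨Set.univ, Set.univ, MeasurableSet.univ, hPu, by simp⟩ integrable_condExp hf ?_ hs
  · rw [generateFrom_interSets m hPu, hP, 
      generateFrom_piiUnionInter_measurableSet (fun j => MeasurableSpace.comap (X j) inferInstance) S]
  · rintro _ ⟨C, D, hC, ⟨J, hJS, E, hE, rfl⟩, rfl⟩
    have hE' : ∀ j ∈ J, ∃ E', MeasurableSet E' ∧ X j ⁻¹' E' = E j := fun j hj => hE j hj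
    choose! E' hE'm hE'e using hE'
    have hiJ : i ∉ J := fun h => hi (hJS h)
    have hDe : ⋂ j ∈ J, E j = ⋂ j ∈ J, X j ⁻¹' E' j :=
      Set.iInter₂_congr fun j hj => (hE'e j hj).symm
    rw [hDe]
    refine setIntegral_condExp_of_condIndep hm (hcomap i)
      (Finset.measurableSet_biInter J fun j hj => hX j (hE'm j hj)) ?_ hf hfm hC
    rintro _ ⟨B, hB, rfl⟩
    -- Since `i ∉ J`, the event for `X i` joins the others as one more index. Factorization over
    -- `insert i J`, compared with that over `J`, gives the required conditional independence.
    have e : (⋂ j ∈ J, X j ⁻¹' E' j) ∩ X i ⁻¹' B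
        = ⋂ j ∈ insert i J, X j ⁻¹' (Function.update E' i B) j := by
      rw [Finset.set_biInter_insert, Function.update_self, Set.inter_comm]
      congr 1
      exact Set.iInter₂_congr fun j hj => by
        rw [Function.update_of_ne (ne_of_mem_of_not_mem hj hiJ)]
    have hu : ∀ j ∈ insert i J, MeasurableSet (Function.update E' i B j) := fun j hj => by
      rcases eq_or_ne j i with rfl | hne
      · simpa using hB
      · rw [Function.update_of_ne hne]; exact hE'm j ((Finset.mem_insert.1 hj).resolve_left hne)
    have h1 := h (insert i J) (Function.update E' i B) hu
    have h2 := h J E' hE'm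
    rw [e]
    refine h1.trans ?_
    rw [Finset.prod_insert hiJ, Function.update_self, mul_comm]
    have e2 : ∏ j ∈ J, μ[(X j ⁻¹' Function.update E' i B j).indicator (fun _ => (1 : ℝ)) | m]
        = ∏ j ∈ J, μ[(X j ⁻¹' E' j).indicator (fun _ => (1 : ℝ)) | m] :=
      Finset.prod_congr rfl fun j hj => by
        rw [Function.update_of_ne (ne_of_mem_of_not_mem hj hiJ)]
    rw [e2]
    exact h2.symm.mul (ae_eq_refl _)

end

/-! ### Lower tail of the arm counts -/

section

variable {Ω : Type*} {mΩ : MeasurableSpace Ω} {μ : Measure Ω}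

/-- Lower tail bound for the number of events that occur, among events that are conditionally
independent with a common conditional probability `q`. -/
theorem measureReal_le_and_card_lt_le [IsProbabilityMeasure μ] {H : MeasurableSpace Ω} (hH : H ≤ mΩ)
    {ι : Type*} [Fintype ι] [DecidableEq ι] {B : ι → Set Ω} (hB : ∀ i, MeasurableSet[mΩ] (B i))
    [∀ ω, DecidablePred fun i => ω ∈ B i] {q : Ω → ℝ} (hq : StronglyMeasurable[H] q)
    (hq1 : ∀ᵐ ω ∂μ, q ω ≤ 1)
    (h : ∀ J : Finset ι, μ[(⋂ i ∈ J, B i).indicator (fun _ => (1 : ℝ)) | H] =ᵐ[μ]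
      fun ω => q ω ^ J.card) (a : ℝ) (L : ℕ) :
    μ.real {ω | a ≤ q ω ∧ (Finset.univ.filter fun i => ω ∈ B i).card < L}
      ≤ 2 ^ L * Real.exp (-(Fintype.card ι * a / 2)) := by
  set N : Ω → ℕ := fun ω => (Finset.univ.filter fun i => ω ∈ B i).card with hN
  -- Expanding `∏ (1 - 1_{B i} / 2)` over subsets leaves only intersections of the events, whose
  -- conditional probabilities are the hypothesis. The same expansion read backwards gives `(1 -
  -- q/2) ^ n` below, with `n` the number of events.
  have expand : ∀ ω, (1 / 2 : ℝ) ^ N ω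
      = ∑ J : Finset ι, (-1 / 2 : ℝ) ^ J.card * (⋂ i ∈ J, B i).indicator (fun _ => (1 : ℝ)) ω := by
    intro ω
    have e1 : (1 / 2 : ℝ) ^ N ω = ∏ i, (1 + if ω ∈ B i then (-1 / 2 : ℝ) else 0) := by
      rw [hN, ← Finset.prod_const, Finset.prod_filter]
      refine Finset.prod_congr rfl fun i _ => ?_
      split_ifs <;> norm_num
    rw [e1, Finset.prod_one_add, Finset.powerset_univ]
    refine Finset.sum_congr rfl fun J _ => ?_
    by_cases hJ : ∀ i ∈ J, ω ∈ B i
    · rw [Set.indicator_of_mem (by simpa using hJ), mul_one, ← Finset.prod_const]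
      exact Finset.prod_congr rfl fun i hi => if_pos (hJ i hi)
    · rw [Set.indicator_of_notMem (by simpa using hJ), mul_zero]
      push Not at hJ
      obtain ⟨i, hi, hiB⟩ := hJ
      exact Finset.prod_eq_zero hi (if_neg hiB)
  have hJm : ∀ J : Finset ι, MeasurableSet[mΩ] (⋂ i ∈ J, B i) := fun J =>
    Finset.measurableSet_biInter J fun i _ => hB i
  have hJi : ∀ J : Finset ι, Integrable (fun ω => (-1 / 2 : ℝ) ^ J.card *
      (⋂ i ∈ J, B i).indicator (fun _ => (1 : ℝ)) ω) μ := fun J =>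
    ((integrable_const (1 : ℝ)).indicator (hJm J)).const_mul _
  have cond : μ[fun ω => (1 / 2 : ℝ) ^ N ω | H] =ᵐ[μ] fun ω => (1 - q ω / 2) ^ Fintype.card ι := by
    have e : (fun ω => (1 / 2 : ℝ) ^ N ω) = ∑ J : Finset ι, fun ω => (-1 / 2 : ℝ) ^ J.card *
        (⋂ i ∈ J, B i).indicator (fun _ => (1 : ℝ)) ω := by
      ext ω; rw [expand, Finset.sum_apply]
    rw [e]
    refine (condExp_finsetSum (fun J _ => hJi J) H).trans ?_
    have hs : ∀ᵐ ω ∂μ, ∀ J : Finset ι, (μ[fun ω => (-1 / 2 : ℝ) ^ J.card *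
        (⋂ i ∈ J, B i).indicator (fun _ => (1 : ℝ)) ω | H]) ω = (-1 / 2 : ℝ) ^ J.card * q ω ^ J.card := by
      refine ae_all_iff.2 fun J => ?_
      have := condExp_smul ((-1 / 2 : ℝ) ^ J.card) ((⋂ i ∈ J, B i).indicator fun _ => (1 : ℝ)) H (μ := μ)
      filter_upwards [this, h J] with ω h1 h2
      refine h1.trans ?_
      rw [Pi.smul_apply, h2, smul_eq_mul]
    filter_upwards [hs] with ω hω
    rw [Finset.sum_apply, Finset.sum_congr rfl fun J _ => hω J]
    have := Finset.prod_one_add (f := fun _ : ι => -q ω / 2) Finset.univ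
    rw [Finset.powerset_univ] at this
    simp only [Finset.prod_const] at this
    rw [Finset.card_univ] at this
    rw [show 1 - q ω / 2 = 1 + -q ω / 2 by ring, this]
    refine Finset.sum_congr rfl fun J _ => ?_
    rw [← mul_pow]; congr 1; ring
  have hNi : Integrable (fun ω => (1 / 2 : ℝ) ^ N ω) μ := by
    simp_rw [expand]
    exact integrable_finsetSum _ fun J _ => hJi J
  have hC : MeasurableSet[H] {ω | a ≤ q ω} := hq.measurable measurableSet_Ici
  have hNm : MeasurableSet[mΩ] {ω | N ω < L} := by
    have : Measurable[mΩ] N := by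
      have : N = fun ω => ∑ i, (B i).indicator (fun _ => 1) ω := by
        ext ω; simp only [hN, Finset.card_filter, Set.indicator_apply]
      rw [this]
      exact Finset.measurable_sum _ fun i _ => measurable_const.indicator (hB i)
    exact this measurableSet_Iio
  have up : ∫ ω in {ω | a ≤ q ω}, (1 / 2 : ℝ) ^ N ω ∂μ ≤ Real.exp (-(Fintype.card ι * a / 2)) := by
    rw [← setIntegral_condExp hH hNi hC]
    have : ∀ᵐ ω ∂μ.restrict {ω | a ≤ q ω}, (μ[fun ω => (1 / 2 : ℝ) ^ N ω | H]) ω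
        ≤ Real.exp (-(Fintype.card ι * a / 2)) := by
      filter_upwards [ae_restrict_of_ae cond, ae_restrict_of_ae hq1, ae_restrict_mem (hH _ hC)]
        with ω h1 h2 h3
      rw [h1]
      have h3' : a ≤ q ω := h3
      have : 1 - q ω / 2 ≤ Real.exp (-(a / 2)) := by
        have := Real.add_one_le_exp (-(a / 2)); linarith
      -- The bound `q ≤ 1` ensures that the base `1 - q/2` is nonnegative.
      calc _ ≤ Real.exp (-(a / 2)) ^ Fintype.card ι := pow_le_pow_left₀ (by linarith) this _
        _ = _ := by rw [← Real.exp_nat_mul]; congr 1; ring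
    calc _ ≤ ∫ ω in {ω | a ≤ q ω}, Real.exp (-(Fintype.card ι * a / 2)) ∂μ :=
          integral_mono_ae integrable_condExp.integrableOn (integrable_const _) this
      _ = μ.real {ω | a ≤ q ω} * Real.exp (-(Fintype.card ι * a / 2)) := by
          rw [setIntegral_const, smul_eq_mul]
      _ ≤ _ := mul_le_of_le_one_left (Real.exp_pos _).le measureReal_le_one
  -- Markov's inequality: `(1/2) ^ N ≥ (1/2) ^ L` where `N < L`.
  have low : μ.real {ω | a ≤ q ω ∧ N ω < L} * (1 / 2) ^ L
      ≤ ∫ ω in {ω | a ≤ q ω}, (1 / 2 : ℝ) ^ N ω ∂μ := by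
    have hS : MeasurableSet[mΩ] {ω | a ≤ q ω ∧ N ω < L} := (hH _ hC).inter hNm
    calc _ = ∫ ω in {ω | a ≤ q ω ∧ N ω < L}, (1 / 2 : ℝ) ^ L ∂μ := by
          rw [setIntegral_const, smul_eq_mul]
      _ ≤ ∫ ω in {ω | a ≤ q ω ∧ N ω < L}, (1 / 2 : ℝ) ^ N ω ∂μ :=
          setIntegral_mono_on (integrableOn_const (by simp)) hNi.integrableOn hS fun ω hω =>
            pow_le_pow_of_le_one (by norm_num) (by norm_num) hω.2.le
      _ ≤ _ := setIntegral_mono_set hNi.integrableOn (Eventually.of_forall fun ω => by positivity)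
          (Eventually.of_forall fun ω hω => hω.1)
  have : μ.real {ω | a ≤ q ω ∧ N ω < L} = 2 ^ L * (μ.real {ω | a ≤ q ω ∧ N ω < L} * (1 / 2) ^ L) := by
    rw [mul_comm, mul_assoc, ← mul_pow]; norm_num
  rw [this]
  gcongr
  exact low.trans up

end

section

variable {T n : ℕ} {Ω : Type*} {mΩ : MeasurableSpace Ω} {μ : Measure Ω}
  {A : Fin T → Fin n → Ω → Fin 2} {R : Fin T → Fin n → Ω → ℝ}

theorem history_le (hA : ∀ t i, Measurable (A t i)) (hR : ∀ t i, Measurable (R t i)) (t : Fin T) :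
    history A R t ≤ mΩ :=
  iSup_le fun s => iSup_le fun _ => iSup_le fun i => sup_le (hA s i).comap_le (hR s i).comap_le

theorem historyWithActions_le (hA : ∀ t i, Measurable (A t i)) (hR : ∀ t i, Measurable (R t i))
    (t : Fin T) : historyWithActions A R t ≤ mΩ :=
  sup_le (history_le hA hR t) (iSup_le fun i => (hA t i).comap_le)

/-- On the clipping event both `π` and `1 - π` are at least `a`, so the conditional probability of
arm `k` is below `a` at most with the probability that clipping fails; elsewhere the exponential
bound applies. -/
theorem measureReal_armCount_lt_le [IsProbabilityMeasure μ] (hn : 0 < n)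
    (hA : ∀ t i, Measurable (A t i)) (hR : ∀ t i, Measurable (R t i)) {π : Fin T → Ω → ℝ}
    (h : CondIIDActions A R π μ) (t : Fin T) (k : Fin 2) (a : ℝ) (L : ℕ) :
    μ.real {ω | armCount A t k ω < L}
      ≤ (1 - μ.real {ω | π t ω ∈ Set.Icc a (1 - a)}) + 2 ^ L * Real.exp (-(n * a / 2)) := by
  classical
  have hH := history_le hA hR t
  set H := history A R t
  set B : Fin n → Set Ω := fun i => A t i ⁻¹' {k} with hBdef
  have hB : ∀ i, MeasurableSet[mΩ] (B i) := fun i => hA t i (measurableSet_singleton k)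
  -- A version measurable for the history: `π t` is only almost everywhere equal to a conditional
  -- probability and need not be measurable. Sample `0` serves as representative, whence `0 < n`.
  set q : Ω → ℝ := μ[(B ⟨0, hn⟩).indicator (fun _ => (1 : ℝ)) | H] with hqdef
  have hπ : ∀ i, μ[(B i).indicator (fun _ => (1 : ℝ)) | H]
      =ᵐ[μ] fun ω => if k = 1 then π t ω else 1 - π t ω := by
    intro i
    have h1 := (h t).2 i
    rcases (show k = 1 ∨ k = 0 by omega) with rfl | rfl
    · simpa using h1
    · have e : (B i).indicator (fun _ => (1 : ℝ))
          = (fun _ => (1 : ℝ)) - (A t i ⁻¹' {1}).indicator (fun _ => (1 : ℝ)) := by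
        ext ω
        rcases (show A t i ω = 1 ∨ A t i ω = 0 by omega) with h | h <;> simp [B, h]
      rw [e]
      refine (condExp_sub (integrable_const _) ((integrable_const _).indicator
        (hA t i (measurableSet_singleton 1))) H).trans ?_
      rw [condExp_const hH]
      filter_upwards [h1] with ω h
      simpa using h
  have hqi : ∀ i, μ[(B i).indicator (fun _ => (1 : ℝ)) | H] =ᵐ[μ] q := fun i =>
    (hπ i).trans (hπ _).symm
  have hqall : ∀ᵐ ω ∂μ, ∀ i, (μ[(B i).indicator (fun _ => (1 : ℝ)) | H]) ω = q ω :=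
    ae_all_iff.2 hqi
  have hprod : ∀ J : Finset (Fin n), μ[(⋂ i ∈ J, B i).indicator (fun _ => (1 : ℝ)) | H] =ᵐ[μ]
      fun ω => q ω ^ J.card := fun J => by
    refine ((h t).1 J (fun _ => {k}) fun _ _ => measurableSet_singleton k).trans ?_
    filter_upwards [hqall] with ω hω
    rw [Finset.prod_apply, Finset.prod_congr rfl fun i _ => hω i, Finset.prod_const]
  have hq1 : ∀ᵐ ω ∂μ, q ω ≤ 1 := by
    have := ae_bdd_abs_condExp_of_ae_bdd_abs (R := (1 : ℝ)) (m := H) (μ := μ)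
      (f := (B ⟨0, hn⟩).indicator fun _ => (1 : ℝ))
      (Eventually.of_forall fun ω => by by_cases h : ω ∈ B ⟨0, hn⟩ <;> simp [h])
    filter_upwards [this] with ω h using (abs_le.1 h).2
  have main := measureReal_le_and_card_lt_le hH hB stronglyMeasurable_condExp hq1 hprod a L
  rw [Fintype.card_fin] at main
  have hqm : MeasurableSet[mΩ] {ω | a ≤ q ω} :=
    hH _ ((stronglyMeasurable_condExp (μ := μ) (m := H)).measurable measurableSet_Ici)
  have h1 : μ.real {ω | π t ω ∈ Set.Icc a (1 - a)} ≤ μ.real {ω | a ≤ q ω} := by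
    refine ENNReal.toReal_mono (measure_ne_top _ _) (measure_mono_ae ?_)
    filter_upwards [hπ ⟨0, hn⟩] with ω h1 h2
    have h2 : π t ω ∈ Set.Icc a (1 - a) := h2
    change a ≤ q ω
    rw [hqdef, h1]
    split_ifs
    · exact h2.1
    · linarith [h2.2]
  have h2 : μ.real {ω | a ≤ q ω}ᶜ = 1 - μ.real {ω | a ≤ q ω} := by
    rw [measureReal_compl hqm, probReal_univ]
  calc _ ≤ μ.real ({ω | a ≤ q ω}ᶜ ∪ {ω | a ≤ q ω ∧ (Finset.univ.filter fun i => ω ∈ B i).card < L}) := by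
        refine measureReal_mono fun ω hω => ?_
        by_cases ha : a ≤ q ω
        · refine Or.inr ⟨ha, lt_of_eq_of_lt ?_ hω⟩
          unfold armCount
          congr 1
          ext i
          simp [B]
        · exact Or.inl ha
    _ ≤ _ := (measureReal_union_le _ _).trans (add_le_add (by rw [h2]; linarith) main)

end

theorem tendsto_measureReal_armCount_lt {T : ℕ} {Ω : ℕ → Type*} [∀ n, MeasurableSpace (Ω n)]
    (P : ∀ n, Measure (Ω n)) [∀ n, IsProbabilityMeasure (P n)]
    (A : ∀ n, Fin T → Fin n → Ω n → Fin 2) (R : ∀ n, Fin T → Fin n → Ω n → ℝ)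
    (π : ∀ n, Fin T → Ω n → ℝ)
    (hA : ∀ n t i, Measurable (A n t i)) (hR : ∀ n t i, Measurable (R n t i))
    (hactions : ∀ n, CondIIDActions (A n) (R n) (π n) (P n)) {f : ℕ → ℝ}
    (hf : Tendsto (fun n : ℕ => (n : ℝ) * f n) atTop atTop) (hclip : Clipping π P f)
    (t : Fin T) (L : ℕ) :
    Tendsto (fun n => (P n).real {ω | ∃ k, armCount (A n) t k ω < L}) atTop (𝓝 0) := by
  have h1 : Tendsto (fun n => (P n).real {ω | π n t ω ∈ Set.Icc (f n) (1 - f n)}) atTop (𝓝 1) := by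
    exact (ENNReal.tendsto_toReal ENNReal.one_ne_top).comp (hclip t)
  have h2 : Tendsto (fun n : ℕ => Real.exp (-(n * f n / 2))) atTop (𝓝 0) :=
    Real.tendsto_exp_neg_atTop_nhds_zero.comp (hf.atTop_div_const (by norm_num))
  have h3 : Tendsto (fun n : ℕ => 2 * ((1 - (P n).real {ω | π n t ω ∈ Set.Icc (f n) (1 - f n)})
      + 2 ^ L * Real.exp (-(n * f n / 2)))) atTop (𝓝 0) := by
    have := ((h1.const_sub 1).add (h2.const_mul (2 ^ L))).const_mul 2
    simpa using this
  refine squeeze_zero' (Eventually.of_forall fun n => measureReal_nonneg) ?_ h3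
  filter_upwards [eventually_gt_atTop 0] with n hn
  calc _ ≤ (P n).real ({ω | armCount (A n) t 0 ω < L} ∪ {ω | armCount (A n) t 1 ω < L}) := by
        refine measureReal_mono fun ω ⟨k, hk⟩ => ?_
        rcases (show k = 0 ∨ k = 1 by omega) with rfl | rfl
        exacts [Or.inl hk, Or.inr hk]
    _ ≤ _ := by
        rw [two_mul]
        exact (measureReal_union_le _ _).trans (add_le_add
          (measureReal_armCount_lt_le hn (hA n) (hR n) (hactions n) t 0 (f n) L)
          (measureReal_armCount_lt_le hn (hA n) (hR n) (hactions n) t 1 (f n) L))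

/-- A superlinear function that is bounded below dominates the tails of the identity. -/
theorem exists_tailSq_le {φ : ℝ → ℝ} (hb : BddBelow (φ '' Set.Ici 0))
    (hφ : Tendsto (fun x => φ x / x) atTop atTop) (M : ℝ) {η : ℝ} (hη : 0 < η) :
    ∃ K δ b : ℝ, 0 ≤ δ ∧ δ * (M + b) ≤ η ∧ ∀ x, tailSq K x ≤ δ * (φ (x ^ 2) + b) := by
  obtain ⟨b₀, hb₀⟩ := hb
  set b := |b₀|
  have hlow : ∀ y, 0 ≤ y → 0 ≤ φ y + b := fun y hy => by
    have := hb₀ ⟨y, hy, rfl⟩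
    linarith [neg_abs_le b₀]
  -- The denominator is positive and dominates `M + b`. The threshold `K` then comes from `φ y / y ≥
  -- 1/δ`, that is `y ≤ δ φ y`; it depends only on `φ`, `M`, `η` and the chosen lower bound of `φ`,
  -- so it is uniform in `n`.
  set δ := η / (|M| + b + 1) with hδ
  have hb0 : 0 ≤ b := abs_nonneg _
  have hpos : 0 < |M| + b + 1 := by positivity
  have hδ0 : 0 < δ := div_pos hη hpos
  obtain ⟨K, hK⟩ := eventually_atTop.1 (hφ.eventually_ge_atTop (1 / δ))
  refine ⟨max K 0, δ, b, hδ0.le, ?_, fun x => ?_⟩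
  · calc δ * (M + b) ≤ δ * (|M| + b + 1) := by exact mul_le_mul_of_nonneg_left (by linarith [le_abs_self M]) hδ0.le
      _ = η := div_mul_cancel₀ _ hpos.ne'
  · unfold tailSq
    split_ifs with h
    · have hx : 0 < x ^ 2 := (le_max_right K 0).trans_lt h
      have := hK (x ^ 2) ((le_max_left K 0).trans h.le)
      rw [div_le_div_iff₀ hδ0 hx] at this
      nlinarith [mul_nonneg hδ0.le hb0]
    · exact mul_nonneg hδ0.le (hlow _ (sq_nonneg x))

/-! ### Errors of one batch given the history and the actions -/

section

variable {T n : ℕ} {Ω : Type*}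
  {A : Fin T → Fin n → Ω → Fin 2} {R : Fin T → Fin n → Ω → ℝ} {β : Fin T → Fin 2 → ℝ}

theorem measurable_action_historyWithActions (t : Fin T) (i : Fin n) :
    Measurable[historyWithActions A R t] (A t i) :=
  (comap_measurable (A t i)).mono
    ((le_iSup (fun i => MeasurableSpace.comap (A t i) inferInstance) i).trans le_sup_right) le_rfl

theorem comap_sup_comap_le_history {s t : Fin T} (hst : s < t) (i : Fin n) :
    MeasurableSpace.comap (A s i) inferInstance ⊔ MeasurableSpace.comap (R s i) inferInstance
      ≤ history A R t :=
  le_iSup_of_le s (le_iSup_of_le hst (le_iSup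
    (fun i => MeasurableSpace.comap (A s i) inferInstance ⊔
      MeasurableSpace.comap (R s i) inferInstance) i))

theorem historyWithActions_le_history {s t : Fin T} (hst : s < t) :
    historyWithActions A R s ≤ history A R t :=
  sup_le (iSup₂_le fun _ hr => iSup_le fun i => comap_sup_comap_le_history (hr.trans hst) i)
    (iSup_le fun i => le_sup_left.trans (comap_sup_comap_le_history hst i))

theorem measurable_error_of_le {m : MeasurableSpace Ω} {t : Fin T} {i : Fin n}
    (hA : Measurable[m] (A t i)) (hR : Measurable[m] (R t i)) :
    Measurable[m] (error A R β t i) :=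
  Measurable.sub hR ((measurable_of_finite (β t)).comp hA)

theorem measurable_error_history {s t : Fin T} (hst : s < t) (i : Fin n) :
    Measurable[history A R t] (error A R β s i) :=
  measurable_error_of_le
    ((comap_measurable (A s i)).mono (le_sup_left.trans (comap_sup_comap_le_history hst i)) le_rfl)
    ((comap_measurable (R s i)).mono (le_sup_right.trans (comap_sup_comap_le_history hst i)) le_rfl)

variable {mΩ : MeasurableSpace Ω} {μ : Measure Ω} [IsProbabilityMeasure μ]

theorem RewardModel.integrable_error (hA : ∀ t i, Measurable (A t i))
    (h : RewardModel A R β μ) (t : Fin T) (i : Fin n) : Integrable (error A R β t i) μ := by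
  have hβ : Measurable fun ω => β t (A t i ω) := (measurable_of_finite (β t)).comp (hA t i)
  refine ((h t).2 i).1.sub (Integrable.of_bound hβ.aestronglyMeasurable (∑ k, |β t k|)
    (Eventually.of_forall fun ω => ?_))
  exact Finset.single_le_sum (f := fun k => |β t k|) (fun k _ => abs_nonneg _) (Finset.mem_univ _)

theorem RewardModel.condExp_error (hA : ∀ t i, Measurable (A t i)) (hR : ∀ t i, Measurable (R t i))
    (h : RewardModel A R β μ) (t : Fin T) (i : Fin n) :
    μ[error A R β t i | historyWithActions A R t] =ᵐ[μ] 0 := by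
  have hβ : Measurable[historyWithActions A R t] fun ω => β t (A t i ω) :=
    (measurable_of_finite (β t)).comp (measurable_action_historyWithActions t i)
  have hG := historyWithActions_le hA hR t
  have hβi : Integrable (fun ω => β t (A t i ω)) μ := by
    have := ((h t).2 i).1.sub (h.integrable_error hA t i)
    refine this.congr (Eventually.of_forall fun ω => ?_)
    simp [error]
  have := condExp_sub ((h t).2 i).1 hβi (historyWithActions A R t)
  rw [condExp_of_stronglyMeasurable hG hβ.stronglyMeasurable hβi] at this
  refine (show μ[error A R β t i | historyWithActions A R t] =ᵐ[μ] _ from this).trans ?_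
  filter_upwards [((h t).2 i).2] with ω h
  simp [h]

/-- Asymptotic conditional normality of the weighted sum of the errors of one batch, in quantitative
form: the weights `w` are determined by the history and the actions, and their squares are small and
add up to `v` when each arm is selected at least `L` times. -/
theorem norm_integral_mul_cexp_sum_error_sub_le (hA : ∀ t i, Measurable (A t i))
    (hR : ∀ t i, Measurable (R t i)) (h : RewardModel A R β μ) {σ : ℝ} {t : Fin T}
    (hε2 : ∀ i, Integrable (fun ω => error A R β t i ω ^ 2) μ)
    (hσ : ∀ i, μ[fun ω => error A R β t i ω ^ 2 | historyWithActions A R t] =ᵐ[μ] fun _ => σ ^ 2)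
    {K η : ℝ} (hη0 : 0 ≤ η) (hη : ∀ i, ∀ᵐ ω ∂μ,
      (μ[fun ω => tailSq K (error A R β t i ω) | historyWithActions A R t]) ω ≤ η)
    {Z : Ω → ℂ} (hZ : StronglyMeasurable[historyWithActions A R t] Z) (hZ1 : ∀ ω, ‖Z ω‖ ≤ 1)
    {w : Fin n → Ω → ℝ} (hw : ∀ i, Measurable[historyWithActions A R t] (w i))
    {v : ℝ} (hv : 0 ≤ v) {L : ℕ}
    (hsum : ∀ ω, (∀ k, L ≤ armCount A t k ω) → ∑ i, w i ω ^ 2 = v)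
    (hsmall : ∀ ω, (∀ k, L ≤ armCount A t k ω) → ∀ i, w i ω ^ 2 ≤ v / L) :
    ‖∫ ω, Z ω * Complex.exp (Complex.I * ((∑ i, w i ω * error A R β t i ω : ℝ) : ℂ)) ∂μ
        - (∫ ω, Z ω ∂μ) * (Real.exp (-(σ ^ 2 * v / 2)) : ℂ)‖
      ≤ (4 * η + 4 * √(v / L) * √K * σ ^ 2 + √(v / L) ^ 2 * σ ^ 4) * v
        + 4 * μ.real {ω | ∃ k, armCount A t k ω < L} := by
  have hG := historyWithActions_le hA hR t
  set G := historyWithActions A R t with hGdef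
  set bad : Set Ω := {ω | ∃ k, armCount A t k ω < L} with hbad
  have hcount : ∀ k, Measurable[G] (armCount A t k) := fun k => by
    have : armCount A t k = fun ω => ∑ i, if A t i ω = k then 1 else 0 := by
      ext ω; simp only [armCount, Finset.card_filter]
    rw [this]
    exact Finset.measurable_sum _ fun i _ => (measurable_of_finite fun x : Fin 2 =>
      if x = k then 1 else 0).comp (measurable_action_historyWithActions t i)
  have hbadm : MeasurableSet[G] bad := by
    have : bad = ⋃ k, armCount A t k ⁻¹' Set.Iio L := by ext ω; simp [bad]
    rw [this]
    exact MeasurableSet.iUnion fun k => hcount k measurableSet_Iio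
  have hgood : ∀ ω, ω ∉ bad → ∀ k, L ≤ armCount A t k ω := fun ω hω k => by
    by_contra hk; exact hω ⟨k, not_le.1 hk⟩
  -- The replacement lemma needs weights bounded everywhere. Since `bad` belongs to `G`, setting
  -- them to zero there keeps them `G`-measurable.
  set w' : Fin n → Ω → ℝ := fun i => badᶜ.indicator (w i) with hw'
  have hw'm : ∀ i, StronglyMeasurable[G] (w' i) := fun i =>
    ((hw i).indicator hbadm.compl).stronglyMeasurable
  have hw'good : ∀ ω, ω ∉ bad → ∀ i, w' i ω = w i ω := fun ω hω i => Set.indicator_of_mem hω _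
  have hw'bad : ∀ ω, ω ∈ bad → ∀ i, w' i ω = 0 := fun ω hω i =>
    Set.indicator_of_notMem (Set.notMem_compl_iff.2 hω) _
  have hw'c : ∀ i ω, |w' i ω| ≤ √(v / L) := fun i ω => by
    by_cases hω : ω ∈ bad
    · rw [hw'bad ω hω, abs_zero]; exact Real.sqrt_nonneg _
    · rw [hw'good ω hω]; exact Real.abs_le_sqrt (hsmall ω (hgood ω hω) i)
  have hεm : ∀ i, Measurable[mΩ] (error A R β t i) := fun i => measurable_error_of_le (m := mΩ) (hA t i) (hR t i)
  have hAG : ∀ i, Measurable[G] (A t i) := fun i => measurable_action_historyWithActions t i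
  -- the σ-algebras generated by `G` and the rewards before `i`
  set F : Fin n → MeasurableSpace Ω := fun i =>
    G ⊔ ⨆ j ∈ Set.Iio i, MeasurableSpace.comap (R t j) inferInstance with hF
  have hεF : ∀ i j, j < i → StronglyMeasurable[F i] (error A R β t j) := fun i j hij => by
    refine (measurable_error_of_le (m := F i) ((hAG j).mono le_sup_left le_rfl)
      ((comap_measurable (R t j)).mono ?_ le_rfl)).stronglyMeasurable
    exact (le_iSup₂ (f := fun j (_ : j ∈ Set.Iio i) =>
      MeasurableSpace.comap (R t j) inferInstance) j hij).trans le_sup_right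
  have hεi : ∀ i, StronglyMeasurable[G ⊔ MeasurableSpace.comap (R t i) inferInstance]
      (error A R β t i) := fun i =>
    (measurable_error_of_le (m := G ⊔ MeasurableSpace.comap (R t i) inferInstance) ((hAG i).mono le_sup_left le_rfl)
      ((comap_measurable (R t i)).mono le_sup_right le_rfl)).stronglyMeasurable
  have main := norm_integral_mul_prod_cexp_sub_le hG F (fun i => le_sup_left)
    (fun i => sup_le hG (iSup₂_le fun j _ => (hR t j).comap_le)) w' (fun i => error A R β t i)
    hw'm hw'c hεF hεm (h.integrable_error hA t) hε2
    -- Conditional independence discards the earlier rewards contained in `F i`, reducing mean and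
    -- variance to those given `G`.
    (fun i => ((h t).1.condExp_sup_eq hG (hR t) (lt_irrefl i) (h.integrable_error hA t i)
      (hεi i)).trans (h.condExp_error hA hR t i))
    (fun i => ((h t).1.condExp_sup_eq hG (hR t) (lt_irrefl i) (hε2 i) ((hεi i).pow 2)).trans (hσ i))
    hη Z hZ hZ1
  have hZm : AEStronglyMeasurable[mΩ] Z μ := (hZ.mono hG).aestronglyMeasurable
  -- replace the truncated weights
  have cE : Continuous fun x : ℝ => Complex.exp (Complex.I * (x : ℂ)) := by fun_prop
  have cg : Continuous fun x : ℝ => ((Real.exp (-(σ ^ 2 * x ^ 2 / 2)) : ℝ) : ℂ) := by fun_prop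
  have nE : ∀ x : ℝ, ‖Complex.exp (Complex.I * (x : ℂ))‖ = 1 := Complex.norm_exp_I_mul_ofReal
  have ng : ∀ x : ℝ, 0 ≤ x → ‖(Real.exp (-(σ ^ 2 * x / 2)) : ℂ)‖ ≤ 1 := fun x hx => by
    rw [Complex.norm_real, Real.norm_of_nonneg (Real.exp_pos _).le]
    exact Real.exp_le_one_iff.2 (by have : 0 ≤ σ ^ 2 * x := by positivity
                                    linarith)
  -- Used once to restore `w` in the exponential and once to replace `∑ w'ᵢ²` by `v`; together they
  -- cost `4 μ(bad)`.
  have close : ∀ U V : Ω → ℂ, AEStronglyMeasurable[mΩ] U μ → AEStronglyMeasurable[mΩ] V μ →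
      (∀ ω, ‖U ω‖ ≤ 1) → (∀ ω, ‖V ω‖ ≤ 1) → (∀ ω, ω ∉ bad → U ω = V ω) →
      ‖∫ ω, U ω ∂μ - ∫ ω, V ω ∂μ‖ ≤ 2 * μ.real bad := by
    intro U V hU hV hU1 hV1 hUV
    rw [← integral_sub (Integrable.of_bound hU 1 (Eventually.of_forall hU1))
      (Integrable.of_bound hV 1 (Eventually.of_forall hV1))]
    have hb : ∀ ω, ‖U ω - V ω‖ ≤ bad.indicator (fun _ => (2 : ℝ)) ω := fun ω => by
      by_cases hω : ω ∈ bad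
      · rw [Set.indicator_of_mem hω]
        exact (norm_sub_le _ _).trans (by linarith [hU1 ω, hV1 ω])
      · simp [hω, hUV ω hω]
    refine (norm_integral_le_of_norm_le ((integrable_const (2 : ℝ)).indicator (hG _ hbadm))
      (Eventually.of_forall hb)).trans_eq ?_
    rw [integral_indicator_const _ (hG _ hbadm), smul_eq_mul, mul_comm]
  have mul1 : ∀ a b : ℂ, ‖a‖ ≤ 1 → ‖b‖ ≤ 1 → ‖a * b‖ ≤ 1 := fun a b ha hb => by
    rw [norm_mul]; exact mul_le_one₀ ha (norm_nonneg _) hb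
  have prod1 : ∀ g : Fin n → ℂ, (∀ i, ‖g i‖ ≤ 1) → ‖∏ i, g i‖ ≤ 1 := fun g hg => by
    rw [norm_prod]; exact Finset.prod_le_one (fun i _ => norm_nonneg _) fun i _ => hg i
  have c1 : ‖∫ ω, Z ω * Complex.exp (Complex.I * ((∑ i, w i ω * error A R β t i ω : ℝ) : ℂ)) ∂μ
      - ∫ ω, Z ω * ∏ i, Complex.exp (Complex.I * ((w' i ω * error A R β t i ω : ℝ) : ℂ)) ∂μ‖
      ≤ 2 * μ.real bad := by
    refine close _ _ ?_ ?_ (fun ω => mul1 _ _ (hZ1 ω) (nE _).le)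
      (fun ω => mul1 _ _ (hZ1 ω) (prod1 _ fun i => (nE _).le)) fun ω hω => ?_
    · exact hZm.mul (cE.measurable.comp (Finset.measurable_sum _ fun i _ =>
        ((hw i).mono hG le_rfl).mul (hεm i))).aestronglyMeasurable
    · exact hZm.mul (Finset.measurable_prod _ fun i _ => cE.measurable.comp
        (((hw'm i).measurable.mono hG le_rfl).mul (hεm i))).aestronglyMeasurable
    · congr 1
      simp only [hw'good ω hω]
      rw [← Complex.exp_sum, ← Finset.mul_sum, Complex.ofReal_sum]
  have c2 : ‖∫ ω, Z ω * ∏ i, (Real.exp (-(σ ^ 2 * w' i ω ^ 2 / 2)) : ℂ) ∂μ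
      - ∫ ω, Z ω * (Real.exp (-(σ ^ 2 * v / 2)) : ℂ) ∂μ‖ ≤ 2 * μ.real bad := by
    refine close _ _ ?_ ?_ (fun ω => mul1 _ _ (hZ1 ω) (prod1 _ fun i => ng _ (sq_nonneg _)))
      (fun ω => mul1 _ _ (hZ1 ω) (ng _ hv)) fun ω hω => ?_
    · exact hZm.mul (Finset.measurable_prod _ fun i _ => cg.measurable.comp
        ((hw'm i).measurable.mono hG le_rfl)).aestronglyMeasurable
    · exact hZm.mul aestronglyMeasurable_const
    · congr 1
      simp only [hw'good ω hω]
      rw [← Complex.ofReal_prod, ← Real.exp_sum, ← hsum ω (hgood ω hω), Finset.mul_sum,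
        Finset.sum_div, Finset.sum_neg_distrib]
  have c3 : ∑ i, ∫ ω, w' i ω ^ 2 ∂μ ≤ v := by
    have hi : ∀ i, Integrable (fun ω => w' i ω ^ 2) μ := fun i =>
      Integrable.of_bound (((hw'm i).mono hG).pow 2).aestronglyMeasurable (√(v / L) ^ 2)
        (Eventually.of_forall fun ω => by
          rw [Real.norm_of_nonneg (sq_nonneg _), ← sq_abs]
          exact pow_le_pow_left₀ (abs_nonneg _) (hw'c i ω) 2)
    rw [← integral_finsetSum _ fun i _ => hi i]
    calc _ ≤ ∫ _, v ∂μ := integral_mono (integrable_finsetSum _ fun i _ => hi i)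
          (integrable_const _) fun ω => by
            by_cases hω : ω ∈ bad
            · simpa [hw'bad ω hω] using hv
            · simp only [hw'good ω hω]; exact (hsum ω (hgood ω hω)).le
      _ = v := by simp
  rw [integral_mul_const] at c2
  have hC : 0 ≤ 4 * η + 4 * √(v / L) * √K * σ ^ 2 + √(v / L) ^ 2 * σ ^ 4 := by positivity
  have key := main.trans (mul_le_mul_of_nonneg_left c3 hC)
  refine (norm_sub_le_norm_sub_add_norm_sub _ (∫ ω, Z ω * ∏ i, Complex.exp (Complex.I *
    ((w' i ω * error A R β t i ω : ℝ) : ℂ)) ∂μ) _).trans ?_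
  refine (add_le_add c1 ((norm_sub_le_norm_sub_add_norm_sub _ (∫ ω, Z ω * ∏ i,
    (Real.exp (-(σ ^ 2 * w' i ω ^ 2 / 2)) : ℂ) ∂μ) _).trans (add_le_add key c2))).trans ?_
  linarith

theorem WeakMoments.condExp_tailSq_le {σ M : ℝ} {φ : ℝ → ℝ} (hA : ∀ t i, Measurable (A t i))
    (hR : ∀ t i, Measurable (R t i)) (hm : WeakMoments A R β σ φ M μ)
    {K δ b : ℝ} (hδ : 0 ≤ δ) (hK : ∀ x, tailSq K x ≤ δ * (φ (x ^ 2) + b)) (t : Fin T) (i : Fin n) :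
    ∀ᵐ ω ∂μ, (μ[fun ω => tailSq K (error A R β t i ω) | historyWithActions A R t]) ω
      ≤ δ * (M + b) := by
  obtain ⟨h2, -, hφ, hM⟩ := hm t i
  have hG := historyWithActions_le hA hR t
  have hti : Integrable (fun ω => tailSq K (error A R β t i ω)) μ := by
    refine h2.mono ((measurable_tailSq K).comp (measurable_error_of_le (hA t i) (hR t i))).aestronglyMeasurable
      (Eventually.of_forall fun ω => ?_)
    rw [Real.norm_of_nonneg (tailSq_nonneg _ _), Real.norm_of_nonneg (sq_nonneg _)]
    exact tailSq_le _ _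
  have e1 := condExp_smul δ ((fun ω => φ (error A R β t i ω ^ 2)) + fun _ => b)
    (historyWithActions A R t) (μ := μ)
  have e2 := condExp_add hφ (integrable_const b) (historyWithActions A R t) (μ := μ)
  rw [condExp_const hG] at e2
  have e3 := condExp_mono (m := historyWithActions A R t) hti
    ((hφ.add (integrable_const b)).smul δ) (Eventually.of_forall fun ω => hK (error A R β t i ω))
  filter_upwards [e1, e2, e3, hM] with ω h1 h2 h3 h4
  refine h3.trans ?_
  rw [h1, Pi.smul_apply, h2, Pi.add_apply, smul_eq_mul]
  gcongr

end

/-! ### Limit for one batch -/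

section

variable {T : ℕ} {Ω : ℕ → Type*} [∀ n, MeasurableSpace (Ω n)]
  {P : ∀ n, Measure (Ω n)} [∀ n, IsProbabilityMeasure (P n)]
  {A : ∀ n, Fin T → Fin n → Ω n → Fin 2} {R : ∀ n, Fin T → Fin n → Ω n → ℝ}
  {π : ∀ n, Fin T → Ω n → ℝ} {β : Fin T → Fin 2 → ℝ} {σ M : ℝ} {φ : ℝ → ℝ} {f : ℕ → ℝ}

/-- One batch asymptotically contributes an independent Gaussian factor to the characteristic
function. -/
theorem tendsto_integral_mul_cexp_sum_error_sub
    (hA : ∀ n t i, Measurable (A n t i)) (hR : ∀ n t i, Measurable (R n t i))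
    (hreward : ∀ n, RewardModel (A n) (R n) β (P n))
    (hactions : ∀ n, CondIIDActions (A n) (R n) (π n) (P n))
    (hb : BddBelow (φ '' Set.Ici 0)) (hφ : Tendsto (fun x => φ x / x) atTop atTop)
    (hm : ∀ n, WeakMoments (A n) (R n) β σ φ M (P n))
    (hf : Tendsto (fun n : ℕ => (n : ℝ) * f n) atTop atTop) (hclip : Clipping π P f)
    (t : Fin T) {Z : ∀ n, Ω n → ℂ}
    (hZ : ∀ n, StronglyMeasurable[historyWithActions (A n) (R n) t] (Z n))
    (hZ1 : ∀ n ω, ‖Z n ω‖ ≤ 1) {w : ∀ n, Fin n → Ω n → ℝ}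
    (hw : ∀ n i, Measurable[historyWithActions (A n) (R n) t] (w n i)) {v : ℝ} (hv : 0 ≤ v)
    (hsum : ∀ n ω, (∀ k, 1 ≤ armCount (A n) t k ω) → ∑ i, w n i ω ^ 2 = v)
    (hsmall : ∀ (L : ℕ), 1 ≤ L → ∀ n ω, (∀ k, L ≤ armCount (A n) t k ω) → ∀ i, w n i ω ^ 2 ≤ v / L) :
    Tendsto (fun n => ∫ ω, Z n ω * Complex.exp (Complex.I *
        ((∑ i, w n i ω * error (A n) (R n) β t i ω : ℝ) : ℂ)) ∂(P n)
      - (∫ ω, Z n ω ∂(P n)) * (Real.exp (-(σ ^ 2 * v / 2)) : ℂ)) atTop (𝓝 0) := by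
  rw [Metric.tendsto_atTop']
  intro e he
  -- The order of choices matters: `K` makes the tail term at most `e/4`, then `L` (depending on
  -- `K`) controls the weight terms, then `n` (depending on `L`) controls the bad event. Using `v +
  -- 1` avoids dividing by zero when `v = 0`.
  obtain ⟨K, δ, b, hδ, hδη, hK⟩ := exists_tailSq_le hb hφ M (η := e / (16 * (v + 1))) (by positivity)
  have hL : Tendsto (fun L : ℕ => (4 * √(v / L) * √K * σ ^ 2 + √(v / L) ^ 2 * σ ^ 4) * v)
      atTop (𝓝 0) := by
    have h0 : Tendsto (fun L : ℕ => √(v / L)) atTop (𝓝 0) := by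
      have := (tendsto_const_div_atTop_nhds_zero_nat v).sqrt
      simpa using this
    have := (((((h0.const_mul 4).mul_const √K).mul_const (σ ^ 2)).add
      ((h0.pow 2).mul_const (σ ^ 4))).mul_const v)
    simpa using this
  obtain ⟨L, hLe, hL1⟩ := ((hL.eventually (gt_mem_nhds (show (0 : ℝ) < e / 4 by positivity))).and
    (eventually_ge_atTop 1)).exists
  have hP := tendsto_measureReal_armCount_lt P A R π hA hR hactions hf hclip t L
  obtain ⟨n₀, hn₀⟩ := eventually_atTop.1 (hP.eventually (gt_mem_nhds (show (0 : ℝ) < e / 16 by positivity)))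
  refine ⟨n₀, fun n hn => ?_⟩
  rw [dist_zero_right]
  have hb := norm_integral_mul_cexp_sum_error_sub_le (hA n) (hR n) (hreward n)
    (fun i => (hm n t i).1) (fun i => (hm n t i).2.1) (η := e / (16 * (v + 1))) (by positivity)
    (fun i => ((hm n).condExp_tailSq_le (hA n) (hR n) hδ hK t i).mono fun ω h => h.trans hδη)
    (hZ n) (hZ1 n) (hw n) hv (L := L)
    (fun ω h => hsum n ω fun k => hL1.trans (h k)) (fun ω h => hsmall L hL1 n ω h)
  have h1 : 4 * (e / (16 * (v + 1))) * v ≤ e / 4 := by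
    have : e / (16 * (v + 1)) * v ≤ e / 16 := by
      rw [div_mul_eq_mul_div, div_le_div_iff₀ (by positivity) (by norm_num)]
      nlinarith
    linarith
  have h2 := hn₀ n hn.le
  refine hb.trans_lt ?_
  rw [add_assoc, add_mul]
  linarith

end

/-! ### Estimator errors as weighted sums -/

section

variable {T n : ℕ} {Ω : Type*} {A : Fin T → Fin n → Ω → Fin 2} {R : Fin T → Fin n → Ω → ℝ}
  {β : Fin T → Fin 2 → ℝ}

/-- The weight of sample `i` of batch `t` in the linear combination, with coefficients `a k`, of the
normalized errors of the arm estimators of batch `t`. -/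
noncomputable def sampleWeight (A : Fin T → Fin n → Ω → Fin 2) (t : Fin T) (a : Fin 2 → (Fin 2 → ℕ) → ℝ)
    (i : Fin n) (ω : Ω) : ℝ :=
  a (A t i ω) (fun k => armCount A t k ω) * (√(armCount A t (A t i ω) ω : ℝ))⁻¹

/-- Valid for an empty arm too: both sides vanish because `√0 = 0` and `0⁻¹ = 0`. -/
theorem sqrt_armCount_mul_sub (t : Fin T) (k : Fin 2) (ω : Ω) :
    √(armCount A t k ω : ℝ) * (armEstimator A R t k ω - β t k)
      = (√(armCount A t k ω : ℝ))⁻¹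
        * ∑ i ∈ Finset.univ.filter (fun i => A t i ω = k), error A R β t i ω := by
  have h : ∑ i ∈ Finset.univ.filter (fun i => A t i ω = k), error A R β t i ω
      = ∑ i ∈ Finset.univ.filter (fun i => A t i ω = k), R t i ω - armCount A t k ω * β t k := by
    have : ∀ i ∈ Finset.univ.filter (fun i => A t i ω = k), error A R β t i ω = R t i ω - β t k :=
      fun i hi => by rw [error, (Finset.mem_filter.1 hi).2]
    rw [Finset.sum_congr rfl this, Finset.sum_sub_distrib, Finset.sum_const, nsmul_eq_mul, armCount]
  rw [h, armEstimator]
  rcases Nat.eq_zero_or_pos (armCount A t k ω) with h0 | h0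
  · simp [h0]
  · have hN : (0 : ℝ) < armCount A t k ω := by exact_mod_cast h0
    have hs := Real.sq_sqrt hN.le
    have hs0 := (Real.sqrt_pos.2 hN).ne'
    field_simp
    rw [hs]

theorem sum_mul_sqrt_armCount_mul_sub (t : Fin T) (a : Fin 2 → (Fin 2 → ℕ) → ℝ) (ω : Ω) :
    ∑ k, a k (fun k => armCount A t k ω)
        * (√(armCount A t k ω : ℝ) * (armEstimator A R t k ω - β t k))
      = ∑ i, sampleWeight A t a i ω * error A R β t i ω := by
  rw [← Finset.sum_fiberwise Finset.univ (fun i => A t i ω)]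
  refine Finset.sum_congr rfl fun k _ => ?_
  rw [sqrt_armCount_mul_sub, ← mul_assoc, Finset.mul_sum]
  exact Finset.sum_congr rfl fun i hi => by rw [sampleWeight, (Finset.mem_filter.1 hi).2]

theorem sum_armCount (t : Fin T) (ω : Ω) : ∑ k, armCount A t k ω = n := by
  have := Finset.card_eq_sum_card_fiberwise (f := fun i => A t i ω) (s := Finset.univ)
    (t := Finset.univ) (fun _ _ => Finset.mem_coe.2 (Finset.mem_univ _))
  rw [Finset.card_univ, Fintype.card_fin] at this
  exact this.symm

theorem sum_sampleWeight_sq (t : Fin T) (a : Fin 2 → (Fin 2 → ℕ) → ℝ) {ω : Ω}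
    (hN : ∀ k, 1 ≤ armCount A t k ω) :
    ∑ i, sampleWeight A t a i ω ^ 2 = ∑ k, a k (fun k => armCount A t k ω) ^ 2 := by
  rw [← Finset.sum_fiberwise Finset.univ (fun i => A t i ω)]
  refine Finset.sum_congr rfl fun k _ => ?_
  have hk : (0 : ℝ) < armCount A t k ω := by exact_mod_cast hN k
  have : ∀ i ∈ Finset.univ.filter (fun i => A t i ω = k), sampleWeight A t a i ω ^ 2
      = a k (fun k => armCount A t k ω) ^ 2 * (armCount A t k ω : ℝ)⁻¹ := fun i hi => by
    rw [sampleWeight, (Finset.mem_filter.1 hi).2, mul_pow, inv_pow, Real.sq_sqrt hk.le]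
  rw [Finset.sum_congr rfl this, Finset.sum_const, nsmul_eq_mul]
  change (armCount A t k ω : ℝ) * _ = _
  field_simp

theorem sampleWeight_sq_le (t : Fin T) (a : Fin 2 → (Fin 2 → ℕ) → ℝ) {L : ℕ} (hL : 1 ≤ L) {ω : Ω}
    (hN : ∀ k, L ≤ armCount A t k ω) (i : Fin n) :
    sampleWeight A t a i ω ^ 2 ≤ (∑ k, a k (fun k => armCount A t k ω) ^ 2) / L := by
  rw [sampleWeight, mul_pow, inv_pow, Real.sq_sqrt (Nat.cast_nonneg _), ← div_eq_mul_inv]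
  gcongr
  · exact Finset.single_le_sum (f := fun k => a k (fun k => armCount A t k ω) ^ 2)
      (fun _ _ => sq_nonneg _) (Finset.mem_univ _)
  · exact hN _

/-- The weight is a function of the action vector of the batch alone, which takes finitely many
values, so any coefficient function `a` is allowed. -/
theorem measurable_sampleWeight (t : Fin T) (a : Fin 2 → (Fin 2 → ℕ) → ℝ) (i : Fin n) :
    Measurable[historyWithActions A R t] (sampleWeight A t a i) := by
  have h : Measurable[historyWithActions A R t] fun ω (j : Fin n) => A t j ω :=
    @measurable_pi_lambda _ _ _ (historyWithActions A R t) _ _ fun j => measurable_action_historyWithActions t j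
  exact (measurable_of_finite fun x : Fin n → Fin 2 =>
    a (x i) (fun k => (Finset.univ.filter fun j => x j = k).card)
      * (√((Finset.univ.filter fun j => x j = x i).card : ℝ))⁻¹).comp h

theorem measurable_armErrorVector_apply [MeasurableSpace Ω] (hA : ∀ t i, Measurable (A t i))
    (hR : ∀ t i, Measurable (R t i)) (t : Fin T) (k : Fin 2) :
    Measurable fun ω => √(armCount A t k ω : ℝ) * (armEstimator A R t k ω - β t k) := by
  have e : (fun ω => √(armCount A t k ω : ℝ) * (armEstimator A R t k ω - β t k))
      = fun ω => ∑ i, sampleWeight A t (fun l _ => if l = k then 1 else 0) i ω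
        * error A R β t i ω := by
    ext ω
    rw [← sum_mul_sqrt_armCount_mul_sub]
    simp
  rw [e]
  exact Finset.measurable_sum _ fun i _ =>
    ((measurable_sampleWeight (R := R) t _ i).mono (historyWithActions_le hA hR t) le_rfl).mul
      (measurable_error_of_le (hA t i) (hR t i))

/-- The margin errors are linear combinations of the arm errors. -/
theorem marginErrorVector_apply (t : Fin T) (ω : Ω) :
    marginErrorVector A R β ω t
      = √(armCount A t 0 ω / n : ℝ) *
          (√(armCount A t 1 ω : ℝ) * (armEstimator A R t 1 ω - β t 1))
        - √(armCount A t 1 ω / n : ℝ) *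
          (√(armCount A t 0 ω : ℝ) * (armEstimator A R t 0 ω - β t 0)) := by
  have h0 : (0 : ℝ) ≤ armCount A t 0 ω := Nat.cast_nonneg _
  have h1 : (0 : ℝ) ≤ armCount A t 1 ω := Nat.cast_nonneg _
  change √((armCount A t 0 ω : ℝ) * (armCount A t 1 ω : ℝ) / (n : ℝ)) * _ = _
  rw [marginEstimator, margin, ← mul_assoc, ← mul_assoc, ← Real.sqrt_mul (by positivity),
    ← Real.sqrt_mul (by positivity)]
  rw [div_mul_eq_mul_div, div_mul_eq_mul_div, mul_comm (armCount A t 1 ω : ℝ)]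
  ring

end

/-! ### Induction over batches and convergence in distribution -/

section

variable {T : ℕ} {Ω : ℕ → Type*} [∀ n, MeasurableSpace (Ω n)]
  {P : ∀ n, Measure (Ω n)} [∀ n, IsProbabilityMeasure (P n)]
  {A : ∀ n, Fin T → Fin n → Ω n → Fin 2} {R : ∀ n, Fin T → Fin n → Ω n → ℝ}
  {π : ∀ n, Fin T → Ω n → ℝ} {β : Fin T → Fin 2 → ℝ} {σ M : ℝ} {φ : ℝ → ℝ} {f : ℕ → ℝ}

/-- Limit of the characteristic functions of linear combinations of the normalized errors of the
arm estimators, with coefficients that may depend on the arm counts. -/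
theorem tendsto_integral_cexp_sum_armError
    (hA : ∀ n t i, Measurable (A n t i)) (hR : ∀ n t i, Measurable (R n t i))
    (hreward : ∀ n, RewardModel (A n) (R n) β (P n))
    (hactions : ∀ n, CondIIDActions (A n) (R n) (π n) (P n))
    (hb : BddBelow (φ '' Set.Ici 0)) (hφ : Tendsto (fun x => φ x / x) atTop atTop)
    (hm : ∀ n, WeakMoments (A n) (R n) β σ φ M (P n))
    (hf : Tendsto (fun n : ℕ => (n : ℝ) * f n) atTop atTop) (hclip : Clipping π P f)
    (a : ℕ → Fin T → Fin 2 → (Fin 2 → ℕ) → ℝ) {v : Fin T → ℝ} (hv : ∀ t, 0 ≤ v t)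
    (ha : ∀ n t N, (∀ k, 1 ≤ N k) → ∑ k, N k = n → ∑ k, a n t k N ^ 2 = v t) :
    Tendsto (fun n => ∫ ω, Complex.exp (Complex.I * ((∑ t, ∑ k,
        a n t k (fun k => armCount (A n) t k ω) * (√(armCount (A n) t k ω : ℝ)
          * (armEstimator (A n) (R n) t k ω - β t k)) : ℝ) : ℂ)) ∂(P n)) atTop
      (𝓝 (Real.exp (-(σ ^ 2 * (∑ t, v t) / 2)) : ℂ)) := by
  simp_rw [sum_mul_sqrt_armCount_mul_sub]
  set S : ∀ n, Fin T → Ω n → ℝ := fun n t ω =>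
    ∑ i, sampleWeight (A n) t (a n t) i ω * error (A n) (R n) β t i ω
  -- Induction on the number `s` of initial batches; their joint exponential plays the role of `Z`
  -- for batch `s`.
  have key : ∀ s : ℕ, s ≤ T → Tendsto (fun n => ∫ ω, Complex.exp (Complex.I *
      ((∑ t ∈ Finset.univ.filter (fun t : Fin T => (t : ℕ) < s), S n t ω : ℝ) : ℂ)) ∂(P n)) atTop
      (𝓝 (Real.exp (-(σ ^ 2 * (∑ t ∈ Finset.univ.filter (fun t : Fin T => (t : ℕ) < s), v t) / 2)) : ℂ)) := by
    intro s
    induction s with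
    | zero => intro _; simp
    | succ s ih =>
      intro hs
      have IH := ih (Nat.le_of_succ_le hs)
      set t₀ : Fin T := ⟨s, hs⟩
      have hfilter : Finset.univ.filter (fun t : Fin T => (t : ℕ) < s + 1)
          = insert t₀ (Finset.univ.filter (fun t : Fin T => (t : ℕ) < s)) := by
        ext t
        simp only [Finset.mem_filter, Finset.mem_univ, true_and, Finset.mem_insert, t₀, Fin.ext_iff]
        omega
      have hnot : t₀ ∉ Finset.univ.filter (fun t : Fin T => (t : ℕ) < s) := by simp [t₀]
      set Z : ∀ n, Ω n → ℂ := fun n ω => Complex.exp (Complex.I *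
        ((∑ t ∈ Finset.univ.filter (fun t : Fin T => (t : ℕ) < s), S n t ω : ℝ) : ℂ)) with hZdef
      have hZ : ∀ n, StronglyMeasurable[historyWithActions (A n) (R n) t₀] (Z n) := fun n => by
        have cE : Continuous fun x : ℝ => Complex.exp (Complex.I * (x : ℂ)) := by fun_prop
        refine (cE.measurable.comp (Finset.measurable_sum _ fun t ht =>
          Finset.measurable_sum _ fun i _ => ?_)).stronglyMeasurable
        have htt : t < t₀ := (Finset.mem_filter.1 ht).2
        exact ((measurable_sampleWeight (R := R n) t _ i).mono
          ((historyWithActions_le_history htt).trans le_sup_left) le_rfl).mul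
          ((measurable_error_history htt i).mono le_sup_left le_rfl)
      have step := tendsto_integral_mul_cexp_sum_error_sub hA hR hreward hactions hb hφ hm hf hclip
        t₀ hZ (fun n ω => (Complex.norm_exp_I_mul_ofReal _).le)
        (w := fun n i => sampleWeight (A n) t₀ (a n t₀) i)
        (fun n i => measurable_sampleWeight t₀ _ i) (hv t₀)
        (fun n ω h => (sum_sampleWeight_sq t₀ _ h).trans (ha n t₀ _ h (sum_armCount t₀ ω)))
        (fun L hL n ω h i => (sampleWeight_sq_le t₀ _ hL h i).trans_eq (by
          rw [ha n t₀ _ (fun k => hL.trans (h k)) (sum_armCount t₀ ω)]))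
      -- Adding back the product of the earlier integral and the new Gaussian factor turns the
      -- vanishing difference into the limit for `s + 1` batches.
      have := step.add (IH.mul_const (Real.exp (-(σ ^ 2 * v t₀ / 2)) : ℂ))
      rw [zero_add, ← Complex.ofReal_mul, ← Real.exp_add] at this
      rw [hfilter, Finset.sum_insert hnot]
      refine (this.congr fun n => ?_).trans_eq ?_
      · rw [sub_add_cancel]
        refine integral_congr_ae (Eventually.of_forall fun ω => ?_)
        simp only [hZdef, Finset.sum_insert hnot]
        rw [← Complex.exp_add]
        congr 1
        have hS : S n t₀ ω
            = ∑ i, sampleWeight (A n) t₀ (a n t₀) i ω * error (A n) (R n) β t₀ i ω := rfl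
        rw [hS]
        push_cast
        ring
      · congr 3; ring
  have := key T le_rfl
  simp only [Fin.is_lt, Finset.filter_true] at this
  exact this

/-- Lévy's continuity theorem, with the characteristic functions written in coordinates. Positive
semidefiniteness of `σ² I` is enough, so the degenerate case `σ = 0` is included. -/
theorem tendstoInDistribution_isotropicGaussian {ι : Type*} [Fintype ι] [DecidableEq ι]
    {X : ∀ n, Ω n → EuclideanSpace ℝ ι} (hX : ∀ n, AEMeasurable (X n) (P n))
    (h : ∀ θ : ι → ℝ, Tendsto (fun n => ∫ ω, Complex.exp (Complex.I *
      ((∑ i, θ i * X n ω i : ℝ) : ℂ)) ∂(P n)) atTop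
      (𝓝 (Real.exp (-(σ ^ 2 * (∑ i, θ i ^ 2) / 2)) : ℂ))) :
    TendstoInDistribution X atTop (id : EuclideanSpace ℝ ι → EuclideanSpace ℝ ι) P
      (isotropicGaussian ι σ) where
  forall_aemeasurable := hX
  aemeasurable_limit := aemeasurable_id
  tendsto := by
    refine ProbabilityMeasure.tendsto_iff_tendsto_charFun.2 fun θ => ?_
    have hS : (σ ^ 2 • (1 : Matrix ι ι ℝ)).PosSemidef := Matrix.PosSemidef.one.smul (sq_nonneg σ)
    have lim : charFun ((isotropicGaussian ι σ).map id) θ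
        = (Real.exp (-(σ ^ 2 * (∑ i, θ i ^ 2) / 2)) : ℂ) := by
      rw [Measure.map_id, isotropicGaussian, charFun_multivariateGaussian hS]
      have : θ.ofLp ⬝ᵥ (σ ^ 2 • (1 : Matrix ι ι ℝ)).mulVec θ.ofLp = σ ^ 2 * ∑ i, θ i ^ 2 := by
        simp [Matrix.smul_mulVec, dotProduct, Finset.mul_sum, pow_two]
        refine Finset.sum_congr rfl fun i _ => by ring
      rw [this]
      simp
    change Tendsto (fun n => charFun ((P n).map (X n)) θ) atTop (𝓝 (charFun ((isotropicGaussian ι σ).map id) θ))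
    rw [lim]
    refine (h θ).congr fun n => ?_
    rw [charFun_apply, integral_map (hX n) (by fun_prop)]
    refine integral_congr_ae (Eventually.of_forall fun ω => ?_)
    simp only [PiLp.inner_apply]
    rw [mul_comm Complex.I]
    simp

end
end BatchedBandit

/-! ### The arm and margin limits -/

/-- Asymptotic normality of the batched OLS estimator. First part: fourth-moment condition and
clipping at rate `n ^ (-α)`. Second part: the weak moment condition and clipping at any rate `f`
with `n * f n → ∞`, for the per-arm and for the margin estimators. -/
theorem mainTheorem1 {T : ℕ} {Ω : ℕ → Type*} [∀ n, MeasurableSpace (Ω n)]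
    (P : ∀ n, Measure (Ω n)) [∀ n, IsProbabilityMeasure (P n)]
    (A : ∀ n, Fin T → Fin n → Ω n → Fin 2) (R : ∀ n, Fin T → Fin n → Ω n → ℝ)
    (π : ∀ n, Fin T → Ω n → ℝ) (β : Fin T → Fin 2 → ℝ) (σ : ℝ)
    (hA : ∀ n t i, Measurable (A n t i)) (hR : ∀ n t i, Measurable (R n t i))
    (hreward : ∀ n, BatchedBandit.RewardModel (A n) (R n) β (P n))
    (hactions : ∀ n, BatchedBandit.CondIIDActions (A n) (R n) (π n) (P n)) :
    ((∃ M : ℝ, ∀ n, BatchedBandit.Moments (A n) (R n) β σ M (P n)) →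
      ∀ α : ℝ, 0 ≤ α → α < 1 →
        BatchedBandit.Clipping π P (fun n => 1 / (n : ℝ) ^ α) →
        TendstoInDistribution (fun n => BatchedBandit.marginErrorVector (A n) (R n) β) atTop
          (id : EuclideanSpace ℝ (Fin T) → EuclideanSpace ℝ (Fin T)) P
          (BatchedBandit.isotropicGaussian (Fin T) σ)) ∧
    ((∃ φ : ℝ → ℝ, BddBelow (φ '' Set.Ici 0) ∧ Tendsto (fun x => φ x / x) atTop atTop ∧
        ∃ M : ℝ, ∀ n, BatchedBandit.WeakMoments (A n) (R n) β σ φ M (P n)) →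
      ∀ f : ℕ → ℝ, Tendsto (fun n : ℕ => (n : ℝ) * f n) atTop atTop →
        BatchedBandit.Clipping π P f →
        TendstoInDistribution (fun n => BatchedBandit.armErrorVector (A n) (R n) β) atTop
          (id : EuclideanSpace ℝ (Fin T × Fin 2) → EuclideanSpace ℝ (Fin T × Fin 2)) P
          (BatchedBandit.isotropicGaussian (Fin T × Fin 2) σ) ∧
        TendstoInDistribution (fun n => BatchedBandit.marginErrorVector (A n) (R n) β) atTop
          (id : EuclideanSpace ℝ (Fin T) → EuclideanSpace ℝ (Fin T)) P
          (BatchedBandit.isotropicGaussian (Fin T) σ)) := by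
  have part2 : (∃ φ : ℝ → ℝ, BddBelow (φ '' Set.Ici 0) ∧ Tendsto (fun x => φ x / x) atTop atTop ∧
        ∃ M : ℝ, ∀ n, BatchedBandit.WeakMoments (A n) (R n) β σ φ M (P n)) →
      ∀ f : ℕ → ℝ, Tendsto (fun n : ℕ => (n : ℝ) * f n) atTop atTop →
        BatchedBandit.Clipping π P f →
        TendstoInDistribution (fun n => BatchedBandit.armErrorVector (A n) (R n) β) atTop
          (id : EuclideanSpace ℝ (Fin T × Fin 2) → EuclideanSpace ℝ (Fin T × Fin 2)) P
          (BatchedBandit.isotropicGaussian (Fin T × Fin 2) σ) ∧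
        TendstoInDistribution (fun n => BatchedBandit.marginErrorVector (A n) (R n) β) atTop
          (id : EuclideanSpace ℝ (Fin T) → EuclideanSpace ℝ (Fin T)) P
          (BatchedBandit.isotropicGaussian (Fin T) σ) := by
    rintro ⟨φ, hb, hφ, M, hm⟩ f hf hclip
    refine ⟨BatchedBandit.tendstoInDistribution_isotropicGaussian (fun n => ?_) fun θ => ?_,
      BatchedBandit.tendstoInDistribution_isotropicGaussian (fun n => ?_) fun θ => ?_⟩
    · refine Measurable.aemeasurable ((WithLp.measurable_toLp 2 _).comp
        (measurable_pi_lambda _ fun p => ?_))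
      exact BatchedBandit.measurable_armErrorVector_apply (hA n) (hR n) p.1 p.2
    · have := BatchedBandit.tendsto_integral_cexp_sum_armError hA hR hreward hactions hb hφ hm hf
        hclip (fun n t k _ => θ (t, k)) (v := fun t => ∑ k, θ (t, k) ^ 2)
        (fun t => Finset.sum_nonneg fun k _ => sq_nonneg _) (fun n t N _ _ => rfl)
      rw [← Fintype.sum_prod_type (f := fun p : Fin T × Fin 2 => θ p ^ 2)] at this
      refine this.congr fun n => integral_congr_ae (Eventually.of_forall fun ω => ?_)
      simp only [Fintype.sum_prod_type]
      rfl
    · refine Measurable.aemeasurable ((WithLp.measurable_toLp 2 _).comp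
        (measurable_pi_lambda _ fun t => ?_))
      have hN : ∀ k, Measurable fun ω => (BatchedBandit.armCount (A n) t k ω : ℝ) := fun k => by
        have : (fun ω => (BatchedBandit.armCount (A n) t k ω : ℝ))
            = fun ω => ∑ i, if A n t i ω = k then (1 : ℝ) else 0 := by
          ext ω; simp [BatchedBandit.armCount]
        rw [this]
        exact Finset.measurable_sum _ fun i _ => (measurable_of_finite fun x : Fin 2 =>
          if x = k then (1 : ℝ) else 0).comp (hA n t i)
      have e := funext fun ω => BatchedBandit.marginErrorVector_apply (A := A n) (R := R n) (β := β) t ω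
      change Measurable fun ω => BatchedBandit.marginErrorVector (A n) (R n) β ω t
      rw [e]
      exact (((hN 0).div_const _).sqrt.mul
        (BatchedBandit.measurable_armErrorVector_apply (hA n) (hR n) t 1)).sub
        (((hN 1).div_const _).sqrt.mul
        (BatchedBandit.measurable_armErrorVector_apply (hA n) (hR n) t 0))
    -- The coefficients depend on the counts, but their squares sum to `θ_t² (N₀ + N₁) / n = θ_t²`.
    · have := BatchedBandit.tendsto_integral_cexp_sum_armError hA hR hreward hactions hb hφ hm hf
        hclip (fun n t k N => if k = 0 then -(θ t * √(N 1 / n : ℝ)) else θ t * √(N 0 / n : ℝ))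
        (v := fun t => θ t ^ 2) (fun t => sq_nonneg _) (fun n t N hN hsum => ?_)
      · refine this.congr fun n => integral_congr_ae (Eventually.of_forall fun ω => ?_)
        simp only [BatchedBandit.marginErrorVector_apply, Fin.sum_univ_two]
        congr 3
        push_cast
        refine Finset.sum_congr rfl fun t _ => ?_
        simp
        ring
      · rw [Fin.sum_univ_two] at hsum ⊢
        have h0 : (1 : ℝ) ≤ N 0 := by exact_mod_cast hN 0
        have hn : (n : ℝ) = N 0 + N 1 := by exact_mod_cast hsum.symm
        have h1 : (0 : ℝ) ≤ N 1 := Nat.cast_nonneg _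
        simp only [if_true, one_ne_zero, if_false]
        rw [neg_sq, mul_pow, mul_pow, Real.sq_sqrt (by positivity), Real.sq_sqrt (by positivity), hn]
        have : (N 0 : ℝ) + N 1 ≠ 0 := by positivity
        field_simp
        ring
  -- The first part is the second with `φ x = x²`, so that `φ (ε²) = ε⁴`, and with `n f(n) = n ^ (1
  -- - α)`.
  refine ⟨fun ⟨M, hM⟩ α hα0 hα1 hclip => (part2 ⟨fun x => x ^ 2, ⟨0, ?_⟩, ?_, M, fun n t i => ?_⟩
    _ ?_ hclip).2, part2⟩
  · rintro _ ⟨x, -, rfl⟩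
    positivity
  · refine tendsto_id.congr fun x => ?_
    rcases eq_or_ne x 0 with rfl | hx
    · simp
    · simp [pow_two, hx]
  · have h4 : (fun ω => (BatchedBandit.error (A n) (R n) β t i ω ^ 2) ^ 2)
        = fun ω => BatchedBandit.error (A n) (R n) β t i ω ^ 4 := by
      ext ω; ring
    obtain ⟨m1, m2, m3, m4⟩ := hM n t i
    exact ⟨m1, m2, h4 ▸ m3, h4 ▸ m4⟩
  · have : Tendsto (fun n : ℕ => (n : ℝ) ^ (1 - α)) atTop atTop :=
      (tendsto_rpow_atTop (by linarith)).comp tendsto_natCast_atTop_atTop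
    refine this.congr' ?_
    filter_upwards [eventually_gt_atTop 0] with n hn
    rw [Real.rpow_sub (by exact_mod_cast hn), Real.rpow_one, mul_one_div]
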